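/- Let $0<a<\tfrac13$, let $\mathbb{T}^2=\mathbb{R}^2/(2\pi\mathbb{Z})^2$, and let $G:\mathbb{T}^2\to\mathbb{T}^2$ be the map induced by $$(x,y)\mapsto\bigl(x+2a\sin x+a\sin y+a\sin(x-y),\; y+a\sin x+2a\sin y+a\sin(y-x)\bigr).$$ Then $G$ is a $C^1$ diffeomorphism of $\mathbb{T}^2$ and it is Morse–Smale, that is: (1) its nonwandering set $\Omega(G)$ is finite and consists of hyperbolic fixed or periodic points; (2) for every $z\in\mathbb{T}^2$ the $\omega$-limit set and the $\alpha$-limit set of the orbit of $z$ are each a fixed point or a periodic orbit; (3) the stable and unstable manifolds of all fixed and periodic points intersect transversely. Moreover $\Omega(G)$ consists of exactly six points, all of them hyperbolic fixed points of $G$: one source $(0,0)$; three saddles $(0,\pi)$, $(\pi,0)$, $(\pi,\pi)$; and two sinks $\left(\tfrac{2\pi}{3},\tfrac{4\pi}{3}\right)$, $\left(\tfrac{4\pi}{3},\tfrac{2\pi}{3}\right)$. (A fixed point $p$ is hyperbolic if $DG(p)$ has no complex eigenvalue of modulus $1$; it is a source, respectively a sink, if all eigenvalues have modulus $>1$, respectively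 $<1$, and a saddle if there are eigenvalues of both kinds.) -/

import Mathlib

open Set Filter Topology Function
open scoped Manifold ContDiff Real

/-! ### The circle `ℝ / pℤ` as a smooth manifold -/

noncomputable section

namespace AddCircleManifold

variable (p : ℝ) [hp : Fact (0 < p)]

/-- The charts of `ℝ / pℤ` are the local inverses of the projection `ℝ → ℝ / pℤ` on the
open intervals `(c, c + p)`.  The preferred chart at `x` uses the interval of length `p` centred
at the representative of `x` in `[0, p)`. -/
instance instChartedSpace : ChartedSpace ℝ (AddCircle p) where
  atlas := range fun c : ℝ => (AddCircle.openPartialHomeomorphCoe p c).symm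
  chartAt x :=
    (AddCircle.openPartialHomeomorphCoe p ((AddCircle.equivIco p 0 x : ℝ) - p / 2)).symm
  mem_chart_source x := by
    have h0 := hp.out
    have hx : ((AddCircle.equivIco p 0 x : ℝ) : AddCircle p) = x :=
      (AddCircle.equivIco p 0).symm_apply_apply x
    set r : ℝ := (AddCircle.equivIco p 0 x : ℝ) with hr
    have h := (AddCircle.openPartialHomeomorphCoe p (r - p / 2)).map_source (x := r)
      (show r ∈ Ioo (r - p / 2) (r - p / 2 + p) from ⟨by linarith, by linarith⟩)
    have h' : (r : AddCircle p) ∈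
        (AddCircle.openPartialHomeomorphCoe p (r - p / 2)).symm.source := h
    rwa [hx] at h'
  chart_mem_atlas x := mem_range_self _

/-- The transition maps are locally translations by multiples of `p`. -/
instance instIsManifold (n : WithTop ℕ∞) : IsManifold 𝓘(ℝ, ℝ) n (AddCircle p) := by
  apply isManifold_of_contDiffOn
  rintro _ _ ⟨b, rfl⟩ ⟨c, rfl⟩ t ht
  set e := AddCircle.openPartialHomeomorphCoe p b with he
  set e' := AddCircle.openPartialHomeomorphCoe p c with he'
  have ht1 : t ∈ e.source ∧ (t : AddCircle p) ∈ e'.target := by simpa [e, e'] using ht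
  apply ContDiffAt.contDiffWithinAt
  set s : ℝ := e'.symm (t : AddCircle p) with hs
  have hs1 : s ∈ e'.source := e'.map_target ht1.2
  have hs2 : (s : AddCircle p) = t := e'.right_inv ht1.2
  have hcont : ContinuousAt (fun u : ℝ => u + (s - t)) t := by fun_prop
  have hev : ∀ᶠ u in 𝓝 t, u + (s - t) ∈ e'.source :=
    hcont.eventually (e'.open_source.mem_nhds (by simpa using hs1))
  have key : (fun u : ℝ => u + (s - t)) =ᶠ[𝓝 t]
      (𝓘(ℝ, ℝ) ∘ (e.symm.symm ≫ₕ e'.symm) ∘ 𝓘(ℝ, ℝ).symm) := by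
    filter_upwards [hev] with u hu
    have h1 : ((u + (s - t) : ℝ) : AddCircle p) = u := by
      rw [AddCircle.coe_add, AddCircle.coe_sub, hs2, sub_self, add_zero]
    have h2 : e'.symm ((u + (s - t) : ℝ) : AddCircle p) = u + (s - t) := e'.left_inv hu
    rw [h1] at h2
    exact h2.symm
  exact (ContDiffAt.congr_of_eventuallyEq (by fun_prop) key.symm)

end AddCircleManifold

instance fact_two_pi_pos : Fact (0 < 2 * π) := ⟨Real.two_pi_pos⟩

/-! ### Nonwandering points, hyperbolicity and invariant manifolds -/

section Topological

variable {M : Type*} [TopologicalSpace M]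

/-- The nonwandering set: every neighbourhood of `x` meets one of its forward images
`f ^ n`, `n ≥ 1`. -/
def nonwanderingSet (f : M → M) : Set M :=
  {x | ∀ U ∈ 𝓝 x, ∃ n : ℕ, 1 ≤ n ∧ (f^[n] '' U ∩ U).Nonempty}

/-- The `ω`-limit set of the forward orbit of `x` under `f`. -/
def omegaLimitSet (f : M → M) (x : M) : Set M :=
  omegaLimit atTop (fun (n : ℕ) (y : M) => f^[n] y) {x}

/-- `S` is a periodic orbit (possibly a fixed point). -/
def IsPeriodicOrbit (f : M → M) (S : Set M) : Prop :=
  ∃ p ∈ periodicPts f, S = range fun n : ℕ => f^[n] p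

/-- The return map at a periodic point `p`: `f` iterated over the minimal period of `p`.
For a fixed point this is `f`. -/
def returnMap (f : M → M) (p : M) : M → M := f^[minimalPeriod f p]

/-- The stable manifold `W^s(p)` of a periodic point `p` of `f`, as a set: the points
whose orbit under the return map converges to `p`. -/
def stableSet (f : M → M) (p : M) : Set M :=
  {x | Tendsto (fun n : ℕ => (returnMap f p)^[n] x) atTop (𝓝 p)}

end Topological

section Differentiable

variable {E : Type*} [NormedAddCommGroup E] [NormedSpace ℝ E]
  {H : Type*} [TopologicalSpace H] (I : ModelWithCorners ℝ E H)
  {M : Type*} [TopologicalSpace M] [ChartedSpace H M]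

/-- The tangent space at `x ∈ W^s(p)` of the stable manifold, which is an injectively
immersed submanifold: it consists of the velocities at `x` of the `C¹` curves that lie in `W^s(p)`
and along which the convergence to `p` is locally uniform at the base point.  (Local uniformity
says that the curve is continuous for the intrinsic topology of `W^s(p)`, that is, that
some iterate carries a piece of it around `x` into a given local stable manifold of `p`.) -/
def stableTangent (f : M → M) (p x : M) : Submodule ℝ (TangentSpace I x) :=
  Submodule.span ℝ {v | ∃ γ : ℝ → M, ContMDiff 𝓘(ℝ, ℝ) I 1 γ ∧ γ 0 = x ∧
    (∀ t, γ t ∈ stableSet f p) ∧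
    Tendsto (fun z : ℕ × ℝ => (returnMap f p)^[z.1] (γ z.2)) (atTop ×ˢ 𝓝 0) (𝓝 p) ∧
    (mfderiv 𝓘(ℝ, ℝ) I γ 0 (1 : ℝ) : E) = v}

/-- The derivative at a periodic point `p` of the return map, as an endomorphism of the tangent
space at `p` (which is the model vector space `E`). -/
def returnDeriv (f : M → M) (p : M) : E →L[ℝ] E := mfderiv I I (returnMap f p) p

variable [FiniteDimensional ℝ E]

/-- The multipliers of a periodic point `p`: the complex eigenvalues of the derivative at `p`
of the return map, an endomorphism of the tangent space at `p`. -/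
def multipliers (f : M → M) (p : M) : Set ℂ :=
  {z | Polynomial.aeval z (returnDeriv I f p : E →ₗ[ℝ] E).charpoly = 0}

/-- A periodic point is hyperbolic if no multiplier lies on the unit circle. -/
def IsHyperbolicPeriodicPt (f : M → M) (p : M) : Prop :=
  p ∈ periodicPts f ∧ ∀ z ∈ multipliers I f p, ‖z‖ ≠ 1

/-- A hyperbolic fixed point all of whose multipliers lie outside the closed unit disc. -/
def IsSource (f : M → M) (p : M) : Prop :=
  IsFixedPt f p ∧ IsHyperbolicPeriodicPt I f p ∧ ∀ z ∈ multipliers I f p, 1 < ‖z‖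

/-- A hyperbolic fixed point all of whose multipliers lie inside the open unit disc. -/
def IsSink (f : M → M) (p : M) : Prop :=
  IsFixedPt f p ∧ IsHyperbolicPeriodicPt I f p ∧ ∀ z ∈ multipliers I f p, ‖z‖ < 1

/-- A hyperbolic fixed point with multipliers both inside and outside the unit circle. -/
def IsSaddle (f : M → M) (p : M) : Prop :=
  IsFixedPt f p ∧ IsHyperbolicPeriodicPt I f p ∧
    (∃ z ∈ multipliers I f p, ‖z‖ < 1) ∧ ∃ z ∈ multipliers I f p, 1 < ‖z‖

/-- A Morse–Smale diffeomorphism of a compact smooth manifold.  The unstable manifold of `q` for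
`f` is the stable manifold of `q` for `f⁻¹`. -/
structure IsMorseSmale [IsManifold I ∞ M] [BoundarylessManifold I M] [CompactSpace M]
    [T2Space M] (f : M ≃ₘ^1⟮I, I⟯ M) : Prop where
  finite_nonwandering : (nonwanderingSet f).Finite
  hyperbolic : ∀ p ∈ nonwanderingSet f, IsHyperbolicPeriodicPt I f p
  limit_sets : ∀ x, IsPeriodicOrbit f (omegaLimitSet f x) ∧
    IsPeriodicOrbit f (omegaLimitSet f.symm x)
  transverse : ∀ p ∈ periodicPts f, ∀ q ∈ periodicPts f,
    ∀ x ∈ stableSet f p ∩ stableSet f.symm q,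
      stableTangent I f p x ⊔ stableTangent I f.symm q x = ⊤

end Differentiable

/-! ### The synchronisation map -/

/-- The torus `ℝ² / (2πℤ)²`. -/
abbrev Torus : Type := AddCircle (2 * π) × AddCircle (2 * π)

/-- The model with corners (without boundary) of the torus, with model space `ℝ × ℝ`. -/
abbrev torusModel : ModelWithCorners ℝ (ℝ × ℝ) (ModelProd ℝ ℝ) := 𝓘(ℝ, ℝ).prod 𝓘(ℝ, ℝ)

/-- The point of the torus with coordinates `(x, y)` modulo `2π`. -/
def torusPt (x y : ℝ) : Torus := ((x : AddCircle (2 * π)), (y : AddCircle (2 * π)))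

/-- The sine function on `ℝ / 2πℤ`. -/
def circleSin : AddCircle (2 * π) → ℝ := Real.sin_periodic.lift

/-- The map of the torus induced by
`(x, y) ↦ (x + 2a sin x + a sin y + a sin (x - y), y + a sin x + 2a sin y + a sin (y - x))`. -/
def syncMap (a : ℝ) (z : Torus) : Torus :=
  (z.1 + ((2 * a * circleSin z.1 + a * circleSin z.2 + a * circleSin (z.1 - z.2) : ℝ) :
      AddCircle (2 * π)),
   z.2 + ((a * circleSin z.1 + 2 * a * circleSin z.2 + a * circleSin (z.2 - z.1) : ℝ) :
      AddCircle (2 * π)))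

theorem syncMap_torusPt (a x y : ℝ) :
    syncMap a (torusPt x y) =
      torusPt (x + 2 * a * Real.sin x + a * Real.sin y + a * Real.sin (x - y))
        (y + a * Real.sin x + 2 * a * Real.sin y + a * Real.sin (y - x)) := by
  have h : ∀ t : ℝ, circleSin (t : AddCircle (2 * π)) = Real.sin t := fun t =>
    Function.Periodic.lift_coe _ t
  simp only [syncMap, torusPt, ← AddCircle.coe_sub, h, ← AddCircle.coe_add, add_assoc]

end

/-!
In the plane `syncMap a` is `z ↦ z + a (2p + q, p + 2q)`, where `(p, q)` is minus the gradient of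
`V (x, y) = cos x + cos y + cos (x - y)`. The Taylor bound
`cos (x + h) ≤ cos x - h sin x + h ^ 2 / 2`, applied to the three cosines, shows that `V` decreases
by at least `a (2 - 3a) (p ^ 2 + p q + q ^ 2)` in each step. So `V` is a strict Lyapunov function:
nonwandering points are zeros of `(p, q)`, and every orbit converges to one of them in both
directions of time. In the norm `max (|x|, |y|, |x - y|)` the displacement is `3a`-Lipschitz, whence
the map is a diffeomorphism for `a < 1 / 3`.

The values of `V` at the source, the saddles and the sinks are `3`, `-1` and `-3/2`, so no orbit
joins two distinct saddles, and any other connecting orbit starts at the source or ends in a sink,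
where the unstable, respectively stable, tangent space is the whole plane. A saddle itself lies on
two invariant lines, one of them contracted and the other one expanded.
-/

/-! ### Strict Lyapunov functions -/

section Dynamics

variable {M : Type*} {f : M → M} {p x : M}

theorem isPeriodicOrbit_singleton (hp : IsFixedPt f p) : IsPeriodicOrbit f {p} :=
  ⟨p, ⟨1, one_pos, hp⟩, by simp only [fun n => (hp.iterate n).eq, range_const]⟩

theorem returnMap_of_isFixedPt (hp : IsFixedPt f p) : returnMap f p = f := by
  rw [returnMap, minimalPeriod_eq_one_iff_isFixedPt.2 hp, iterate_one]

variable [TopologicalSpace M]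

theorem mem_stableSet_iff_of_isFixedPt (hp : IsFixedPt f p) :
    x ∈ stableSet f p ↔ Tendsto (fun n : ℕ => f^[n] x) atTop (𝓝 p) := by
  rw [stableSet, mem_ofPred_eq, returnMap_of_isFixedPt hp]

theorem tendsto_iterate_of_isFixedPt (hx : IsFixedPt f x) :
    Tendsto (fun n : ℕ => f^[n] x) atTop (𝓝 x) := by
  simp only [fun n => (hx.iterate n).eq, tendsto_const_nhds]

theorem self_mem_stableSet (hp : IsFixedPt f p) : p ∈ stableSet f p :=
  (mem_stableSet_iff_of_isFixedPt hp).2 (tendsto_iterate_of_isFixedPt hp)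

theorem eq_of_mapClusterPt_of_tendsto {α : Type*} [T2Space M] {l : Filter α} {u : α → M} {y : M}
    (hx : MapClusterPt x l u) (hy : Tendsto u l (𝓝 y)) : x = y :=
  have : (𝓝 x ⊓ 𝓝 y).NeBot := ClusterPt.mono hx hy
  eq_of_nhds_neBot this

theorem omegaLimitSet_eq_singleton [T2Space M]
    (hp : Tendsto (fun n : ℕ => f^[n] x) atTop (𝓝 p)) : omegaLimitSet f x = {p} := by
  ext y
  simp only [omegaLimitSet, mem_omegaLimit_iff_frequently, singleton_inter_nonempty,
    mem_singleton_iff]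
  constructor
  · intro hy
    have hcl : MapClusterPt y atTop fun n : ℕ => f^[n] x := mapClusterPt_iff_frequently.2 hy
    exact eq_of_mapClusterPt_of_tendsto hcl hp
  · rintro rfl n hn
    exact (hp.eventually hn).frequently

theorem tendsto_iterate_of_isolated_mapClusterPt [LocallyCompactSpace M] (hf : Continuous f)
    (hfix : IsFixedPt f p) (hp : MapClusterPt p atTop fun n : ℕ => f^[n] x)
    (hiso : ∀ᶠ q in 𝓝 p, MapClusterPt q atTop (fun n : ℕ => f^[n] x) → q = p) :
    Tendsto (fun n : ℕ => f^[n] x) atTop (𝓝 p) := by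
  refine (compact_basis_nhds p).tendsto_right_iff.2 fun K hK => ?_
  obtain ⟨C, ⟨hCp, hC⟩, hCK⟩ := (compact_basis_nhds p).mem_iff.1 (inter_mem hK.1 hiso)
  set U := interior C ∩ f ⁻¹' interior C
  have hpU : p ∈ U := by
    have hpC : p ∈ interior C := mem_interior_iff_mem_nhds.2 hCp
    exact ⟨hpC, by rwa [mem_preimage, hfix]⟩
  have hU : IsOpen U := isOpen_interior.inter (isOpen_interior.preimage hf)
  -- A cluster point in the compact set `C \ U` would differ from `p`, so from some time on the
  -- orbit, once in `C`, is in `U`, and can no longer leave `C`.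
  have havoid : ∀ᶠ n in atTop, f^[n] x ∉ C \ U := by
    by_contra hcon
    obtain ⟨q, hqC, hq⟩ := (hC.diff hU).exists_mapClusterPt_of_frequently
      (f := fun n : ℕ => f^[n] x) ((not_eventually.1 hcon).mono fun _ => not_not.1)
    exact hqC.2 ((hCK hqC.1).2 hq ▸ hpU)
  obtain ⟨N, hN⟩ := eventually_atTop.1 havoid
  obtain ⟨m, hm, hmC⟩ := frequently_atTop.1 (hp.frequently hCp) N
  filter_upwards [eventually_ge_atTop m] with n hn
  refine (hCK ?_).1
  induction n, hn using Nat.le_induction with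
  | base => exact hmC
  | succ n hn ih =>
    have hnU : f^[n] x ∈ U := by_contra fun hcon => hN n (hm.trans hn) ⟨ih, hcon⟩
    rw [iterate_succ_apply']
    exact interior_subset hnU.2

/-- The orbits of the points of `S` converge to `p` uniformly. -/
def AttractsUniformlyOn (f : M → M) (p : M) (S : Set M) : Prop :=
  ∀ W ∈ 𝓝 p, ∀ᶠ n : ℕ in atTop, MapsTo f^[n] S W

namespace AttractsUniformlyOn

variable {S : Set M} (h : AttractsUniformlyOn f p S)
include h

theorem tendsto_prod {α : Type*} {γ : α → M} {l : Filter α} (hγ : ∀ᶠ t in l, γ t ∈ S) :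
    Tendsto (fun z : ℕ × α => f^[z.1] (γ z.2)) (atTop ×ˢ l) (𝓝 p) := fun W hW =>
  ((h W hW).prod_mk hγ).mono fun _ hz => hz.1 hz.2

theorem tendsto (hx : x ∈ S) : Tendsto (fun n : ℕ => f^[n] x) atTop (𝓝 p) :=
  fun W hW => (h W hW).mono fun _ hn => hn hx

theorem mono {T : Set M} (hT : T ⊆ S) : AttractsUniformlyOn f p T :=
  fun W hW => (h W hW).mono fun _ hn => hn.mono_left hT

theorem preimage_iterate (m : ℕ) : AttractsUniformlyOn f p (f^[m] ⁻¹' S) := fun W hW => by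
  filter_upwards [(tendsto_sub_atTop_nat m).eventually (h W hW), eventually_ge_atTop m]
    with n hn hmn y hy
  rw [← Nat.sub_add_cancel hmn, iterate_add_apply]
  exact hn hy

theorem exists_mem_nhds_of_tendsto (hf : Continuous f) (hS : S ∈ 𝓝 p)
    (hx : Tendsto (fun n : ℕ => f^[n] x) atTop (𝓝 p)) : ∃ U ∈ 𝓝 x, AttractsUniformlyOn f p U := by
  obtain ⟨m, hm⟩ := (hx.eventually (eventually_mem_nhds_iff.2 hS)).exists
  exact ⟨_, (hf.iterate m).continuousAt.preimage_mem_nhds hm, h.preimage_iterate m⟩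

theorem image {N : Type*} [TopologicalSpace N] {g : N → N} {L : M → N} (hL : Semiconj L f g)
    (hc : ContinuousAt L p) : AttractsUniformlyOn g (L p) (L '' S) := fun W hW => by
  filter_upwards [h _ (hc.preimage_mem_nhds hW)] with n hn
  rintro _ ⟨y, hy, rfl⟩
  rw [← (hL.iterate_right n).eq]
  exact hn hy

end AttractsUniformlyOn

end Dynamics

/-- A continuous function that decreases strictly along the nonconstant orbits of a continuous
map. -/
structure IsStrictLyapunov {M : Type*} [TopologicalSpace M] (f : M → M) (V : M → ℝ) : Prop where
  continuous_map : Continuous f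
  continuous : Continuous V
  lt_of_not_isFixedPt : ∀ x, ¬ IsFixedPt f x → V (f x) < V x

namespace IsStrictLyapunov

variable {M : Type*} [TopologicalSpace M] {f g : M → M} {V : M → ℝ} {p q x : M}
  (h : IsStrictLyapunov f V)
include h

theorem apply_le (x : M) : V (f x) ≤ V x := by
  by_cases hx : IsFixedPt f x
  · rw [hx]
  · exact (h.lt_of_not_isFixedPt x hx).le

theorem antitone_iterate (x : M) : Antitone fun n : ℕ => V (f^[n] x) :=
  antitone_nat_of_succ_le fun n => by
    rw [iterate_succ_apply']
    exact h.apply_le _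

theorem le_of_tendsto (hp : Tendsto (fun n : ℕ => f^[n] x) atTop (𝓝 p)) (n : ℕ) :
    V p ≤ V (f^[n] x) :=
  (h.antitone_iterate x).le_of_tendsto ((h.continuous.tendsto p).comp hp) n

theorem isFixedPt_of_tendsto_of_le (hp : Tendsto (fun n : ℕ => f^[n] x) atTop (𝓝 p))
    (hV : V x ≤ V p) : IsFixedPt f x :=
  by_contra fun hx => (h.lt_of_not_isFixedPt x hx).not_ge (hV.trans (h.le_of_tendsto hp 1))

theorem isFixedPt_of_mem_periodicPts (hx : x ∈ periodicPts f) : IsFixedPt f x := by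
  obtain ⟨n, hn, hx⟩ := hx
  by_contra hfix
  have hle : V (f^[n] x) ≤ V (f x) := h.antitone_iterate x hn
  rw [hx] at hle
  exact (h.lt_of_not_isFixedPt x hfix).not_ge hle

theorem nonwanderingSet_eq : nonwanderingSet f = fixedPoints f := by
  refine Subset.antisymm (fun x hx => ?_) fun x hx U hU =>
    ⟨1, le_rfl, x, ⟨x, mem_of_mem_nhds hU, hx⟩, mem_of_mem_nhds hU⟩
  by_contra hfix
  obtain ⟨c, hfc, hcx⟩ := exists_between (h.lt_of_not_isFixedPt x hfix)
  have hU : {y | V (f y) < c ∧ c < V y} ∈ 𝓝 x :=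
    ((h.continuous.comp h.continuous_map).continuousAt.eventually_lt_const hfc).and
      (h.continuous.continuousAt.eventually_const_lt hcx)
  obtain ⟨n, hn, _, ⟨y, hy, rfl⟩, hny⟩ := hx _ hU
  have hle : V (f^[n] y) ≤ V (f y) := h.antitone_iterate y hn
  exact (hny.2.trans_le hle).not_gt hy.1

theorem isFixedPt_of_mapClusterPt [CompactSpace M]
    (hq : MapClusterPt q atTop fun n : ℕ => f^[n] x) : IsFixedPt f q := by
  obtain ⟨l, hl⟩ : ∃ l, Tendsto (fun n : ℕ => V (f^[n] x)) atTop (𝓝 l) :=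
    ⟨_, tendsto_atTop_ciInf (h.antitone_iterate x) ((isCompact_range h.continuous).bddBelow.mono
      (range_subset_iff.2 fun n => mem_range_self _))⟩
  have hV : ∀ y, MapClusterPt y atTop (fun n : ℕ => f^[n] x) → V y = l := fun y hy =>
    eq_of_mapClusterPt_of_tendsto (hy.continuousAt_comp h.continuous.continuousAt) hl
  have hfq : MapClusterPt (f q) atTop fun n : ℕ => f^[n] x := by
    refine MapClusterPt.of_comp (tendsto_add_atTop_nat 1) ?_
    convert hq.continuousAt_comp h.continuous_map.continuousAt using 1
    exact funext fun n => iterate_succ_apply' f n x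
  by_contra hfix
  exact (h.lt_of_not_isFixedPt q hfix).ne ((hV _ hfq).trans (hV _ hq).symm)

theorem exists_tendsto [CompactSpace M] [T2Space M] (hfin : (fixedPoints f).Finite) (x : M) :
    ∃ p, IsFixedPt f p ∧ Tendsto (fun n : ℕ => f^[n] x) atTop (𝓝 p) := by
  obtain ⟨p, hp⟩ : ∃ p, MapClusterPt p atTop fun n : ℕ => f^[n] x :=
    exists_clusterPt_of_compactSpace _
  have hfix := h.isFixedPt_of_mapClusterPt hp
  refine ⟨p, hfix, tendsto_iterate_of_isolated_mapClusterPt h.continuous_map hfix hp ?_⟩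
  have hnhds : (fixedPoints f \ {p})ᶜ ∈ 𝓝 p :=
    hfin.sdiff.isClosed.isOpen_compl.mem_nhds fun hp => hp.2 rfl
  filter_upwards [hnhds] with q hq hcl
  exact not_not.1 fun hne => hq ⟨h.isFixedPt_of_mapClusterPt hcl, hne⟩

theorem neg_of_rightInverse (hg : Continuous g) (hr : RightInverse g f) :
    IsStrictLyapunov g fun x => -V x where
  continuous_map := hg
  continuous := h.continuous.neg
  lt_of_not_isFixedPt x hx := by
    have hlt := h.lt_of_not_isFixedPt (g x) fun hgx => hx (by rwa [IsFixedPt, hr x, eq_comm] at hgx)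
    rw [hr x] at hlt
    exact neg_lt_neg hlt

theorem eq_of_le_of_tendsto [T2Space M] (hg : IsStrictLyapunov g fun x => -V x)
    (hp : Tendsto (fun n : ℕ => f^[n] x) atTop (𝓝 p))
    (hq : Tendsto (fun n : ℕ => g^[n] x) atTop (𝓝 q)) (hV : V q ≤ V p) : x = p ∧ x = q := by
  have hpx : V p ≤ V x := h.le_of_tendsto hp 0
  have hxq : V x ≤ V q := neg_le_neg_iff.1 (hg.le_of_tendsto hq 0)
  have hf := h.isFixedPt_of_tendsto_of_le hp (hxq.trans hV)
  have hg := hg.isFixedPt_of_tendsto_of_le hq (neg_le_neg (hV.trans hpx))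
  exact ⟨tendsto_nhds_unique (tendsto_iterate_of_isFixedPt hf) hp,
    tendsto_nhds_unique (tendsto_iterate_of_isFixedPt hg) hq⟩

end IsStrictLyapunov

/-! ### Tangent spaces of stable manifolds -/

theorem attractsUniformlyOn_ball_of_norm_sub_le {E : Type*} [NormedAddCommGroup E] {h : E → E}
    {p : E} {k r : ℝ} (hk : 0 ≤ k) (hk' : k < 1)
    (hle : ∀ z ∈ Metric.ball p r, ‖h z - p‖ ≤ k * ‖z - p‖) :
    AttractsUniformlyOn h p (Metric.ball p r) := by
  have hmaps : MapsTo h (Metric.ball p r) (Metric.ball p r) := fun z hz =>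
    mem_ball_iff_norm.2 (((hle z hz).trans (mul_le_of_le_one_left (norm_nonneg _) hk'.le)).trans_lt
      (mem_ball_iff_norm.1 hz))
  have hiter (n : ℕ) : ∀ z ∈ Metric.ball p r, ‖h^[n] z - p‖ ≤ k ^ n * ‖z - p‖ := by
    induction n with
    | zero => simp
    | succ n ih =>
      intro z hz
      calc ‖h^[n + 1] z - p‖ ≤ k ^ n * ‖h z - p‖ := ih _ (hmaps hz)
        _ ≤ k ^ n * (k * ‖z - p‖) := by gcongr; exact hle z hz
        _ = k ^ (n + 1) * ‖z - p‖ := by ring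
  intro W hW
  obtain ⟨δ, hδ, hδW⟩ := Metric.mem_nhds_iff.1 hW
  have hlim : Tendsto (fun n : ℕ => k ^ n * r) atTop (𝓝 0) := by
    simpa using (tendsto_pow_atTop_nhds_zero_of_lt_one hk hk').mul_const r
  filter_upwards [hlim.eventually_lt_const hδ] with n hn z hz
  have hzr : ‖z - p‖ ≤ r := (mem_ball_iff_norm.1 hz).le
  exact hδW (mem_ball_iff_norm.2 ((hiter n z hz).trans_lt (hn.trans_le' (by gcongr))))

section Contraction

variable {E : Type*} [NormedAddCommGroup E] [NormedSpace ℝ E] {p : E}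

theorem exists_attractsUniformlyOn_of_hasFDerivAt {h : E → E} {A : E →L[ℝ] E} (hp : h p = p)
    (hA : HasFDerivAt h A p) (hA1 : ‖A‖ < 1) : ∃ U ∈ 𝓝 p, AttractsUniformlyOn h p U := by
  obtain ⟨k, hAk, hk1⟩ := exists_between hA1
  have hev : ∀ᶠ z in 𝓝 p, ‖h z - p‖ ≤ k * ‖z - p‖ := by
    filter_upwards [hA.isLittleO.def (sub_pos.2 hAk)] with z hz
    calc ‖h z - p‖ = ‖(h z - h p - A (z - p)) + A (z - p)‖ := by rw [sub_add_cancel, hp]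
      _ ≤ (k - ‖A‖) * ‖z - p‖ + ‖A‖ * ‖z - p‖ := norm_add_le_of_le hz (A.le_opNorm _)
      _ = k * ‖z - p‖ := by ring
  obtain ⟨r, hr, hball⟩ := Metric.eventually_nhds_iff_ball.1 hev
  exact ⟨_, Metric.ball_mem_nhds p hr,
    attractsUniformlyOn_ball_of_norm_sub_le ((norm_nonneg A).trans hAk.le) hk1 hball⟩

theorem exists_attractsUniformlyOn_of_hasFDerivAt_smul_id {h : E → E} {c : ℝ} (hc : |c| < 1)
    (hp : h p = p) (hd : HasFDerivAt h (c • ContinuousLinearMap.id ℝ E) p) :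
    ∃ U ∈ 𝓝 p, AttractsUniformlyOn h p U := by
  refine exists_attractsUniformlyOn_of_hasFDerivAt hp hd (lt_of_le_of_lt ?_ hc)
  rw [norm_smul, Real.norm_eq_abs]
  exact mul_le_of_le_one_right (abs_nonneg c) ContinuousLinearMap.norm_id_le

theorem exists_attractsUniformlyOn_symm_of_hasFDerivAt_smul_id {e : E ≃ₜ E} {c : ℝ} (hc : 1 < |c|)
    (hp : e p = p) (hd : HasFDerivAt e (c • ContinuousLinearMap.id ℝ E) p) :
    ∃ U ∈ 𝓝 p, AttractsUniformlyOn e.symm p U := by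
  have hc0 : c ≠ 0 := abs_pos.1 (one_pos.trans hc)
  have hp' : e.symm p = p := e.symm_apply_eq.2 hp.symm
  have hd' : HasFDerivAt e.symm (c⁻¹ • ContinuousLinearMap.id ℝ E) p := by
    refine HasFDerivAt.of_local_left_inverse
      (f' := ContinuousLinearEquiv.smulLeft (Units.mk0 c hc0)) e.symm.continuous.continuousAt ?_
      (Eventually.of_forall e.apply_symm_apply)
    rwa [hp']
  exact exists_attractsUniformlyOn_of_hasFDerivAt_smul_id
    (by rw [abs_inv]; exact inv_lt_one_of_one_lt₀ hc) hp' hd'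

end Contraction

section Differentiable

variable {E : Type*} [NormedAddCommGroup E] [NormedSpace ℝ E]
  {H : Type*} [TopologicalSpace H] {I : ModelWithCorners ℝ E H}
  {M : Type*} [TopologicalSpace M] [ChartedSpace H M] {f : M → M} {p : M}

section Tangent

variable {F : Type*} [NormedAddCommGroup F] [NormedSpace ℝ F] {L : F → M}

theorem mfderiv_comp_apply_one {c : ℝ → F} {t : ℝ} {w : F}
    (hL : MDifferentiableAt 𝓘(ℝ, F) I L (c t)) (hc : HasDerivAt c w t) :
    mfderiv 𝓘(ℝ, ℝ) I (L ∘ c) t (1 : ℝ) = mfderiv 𝓘(ℝ, F) I L (c t) w := by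
  have hcomp := (hL.hasMFDerivAt.comp t hc.hasFDerivAt.hasMFDerivAt).mfderiv
  refine (congrArg (fun A : ℝ →L[ℝ] E => A 1) hcomp).trans ?_
  exact congrArg (mfderiv 𝓘(ℝ, F) I L (c t)) (one_smul ℝ w)

theorem mfderiv_mem_stableTangent (hL : ContMDiff 𝓘(ℝ, F) I 1 L) (hp : IsFixedPt f p) {y : F}
    {S : Set F} (hS : S ∈ 𝓝 y) (h : AttractsUniformlyOn f p (L '' S)) (v : F) :
    mfderiv 𝓘(ℝ, F) I L y v ∈ stableTangent I f p (L y) := by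
  obtain ⟨ε, hε, hεS⟩ : ∃ ε : ℝ, 0 < ε ∧ ∀ t ∈ Icc (-ε) ε, y + t • v ∈ S := by
    have hline : Continuous fun t : ℝ => y + t • v := by fun_prop
    have hev : ∀ᶠ t : ℝ in 𝓝 0, y + t • v ∈ S :=
      hline.continuousAt.eventually (by simpa using hS)
    obtain ⟨ε, hε, hball⟩ := Metric.nhds_basis_closedBall.eventually_iff.1 hev
    exact ⟨ε, hε, fun t ht => hball (by simpa [Real.closedBall_eq_Icc] using ht)⟩
  -- The sine keeps the curve in `S` for all times, as the definition of `stableTangent` requires.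
  let c : ℝ → F := fun t => y + (ε * Real.sin t) • v
  have hc0 : c 0 = y := by simp [c]
  have hcS : ∀ t, L (c t) ∈ L '' S := fun t => mem_image_of_mem L
    (hεS _ ⟨by nlinarith [Real.neg_one_le_sin t], by nlinarith [Real.sin_le_one t]⟩)
  have hcd : ContDiff ℝ 1 c := by fun_prop
  have hcv : HasDerivAt c (ε • v) 0 := by
    have hsin : HasDerivAt (fun t => ε * Real.sin t) ε 0 := by
      simpa using (Real.hasDerivAt_sin 0).const_mul ε
    exact (hsin.smul_const v).const_add y
  have hder : (mfderiv 𝓘(ℝ, ℝ) I (L ∘ c) 0 (1 : ℝ) : E) = ε • (mfderiv 𝓘(ℝ, F) I L y v : E) := by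
    refine (mfderiv_comp_apply_one (hL.mdifferentiableAt one_ne_zero) hcv).trans ?_
    rw [hc0]
    exact map_smul _ ε v
  have hmem : ε • mfderiv 𝓘(ℝ, F) I L y v ∈ stableTangent I f p (L y) := by
    refine Submodule.subset_span ⟨L ∘ c, hL.comp hcd.contMDiff, congrArg L hc0, fun t => ?_, ?_, ?_⟩
    · exact (mem_stableSet_iff_of_isFixedPt hp).2 (h.tendsto (hcS t))
    · rw [returnMap_of_isFixedPt hp]
      exact h.tendsto_prod (Eventually.of_forall hcS)
    · exact hder
  exact (Submodule.smul_mem_iff _ hε.ne').1 hmem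

end Tangent

variable [FiniteDimensional ℝ E]

section RealMultipliers

variable {l m : ℝ} (hp : IsFixedPt f p) (h : multipliers I f p = {(l : ℂ), (m : ℂ)})
include hp h

theorem isSource_of_multipliers_eq (hl : 1 < |l|) (hm : 1 < |m|) : IsSource I f p := by
  have hout : ∀ z ∈ multipliers I f p, 1 < ‖z‖ := by simp [h, hl, hm]
  exact ⟨hp, ⟨⟨1, one_pos, hp⟩, fun z hz => (hout z hz).ne'⟩, hout⟩

theorem isSink_of_multipliers_eq (hl : |l| < 1) (hm : |m| < 1) : IsSink I f p := by
  have hin : ∀ z ∈ multipliers I f p, ‖z‖ < 1 := by simp [h, hl, hm]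
  exact ⟨hp, ⟨⟨1, one_pos, hp⟩, fun z hz => (hin z hz).ne⟩, hin⟩

theorem isSaddle_of_multipliers_eq (hl : |l| < 1) (hm : 1 < |m|) : IsSaddle I f p := by
  refine ⟨hp, ⟨⟨1, one_pos, hp⟩, ?_⟩, ⟨l, ?_⟩, ⟨m, ?_⟩⟩ <;> simp [h, hl, hm, hl.ne, hm.ne']

end RealMultipliers

/- Two distinct fixed points are joined by an orbit only from a larger to a smaller value of `V`. -/
theorem IsStrictLyapunov.isMorseSmale [IsManifold I ∞ M] [BoundarylessManifold I M] [CompactSpace M]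
    [T2Space M] {G : M ≃ₘ^1⟮I, I⟯ M} {V : M → ℝ} (h : IsStrictLyapunov G V)
    (hfin : (fixedPoints G).Finite) (hhyp : ∀ p ∈ fixedPoints G, IsHyperbolicPeriodicPt I G p)
    (hself : ∀ p ∈ fixedPoints G, stableTangent I G p p ⊔ stableTangent I G.symm p p = ⊤)
    (hlt : ∀ p ∈ fixedPoints G, ∀ q ∈ fixedPoints G, V p < V q →
      ∀ x ∈ stableSet G p ∩ stableSet G.symm q,
        stableTangent I G p x ⊔ stableTangent I G.symm q x = ⊤) :
    IsMorseSmale I G := by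
  have hinv : IsStrictLyapunov G.symm fun x => -V x :=
    h.neg_of_rightInverse G.symm.continuous G.apply_symm_apply
  have hfix {p : M} (hp : IsFixedPt G.symm p) : IsFixedPt G p :=
    hp.to_leftInverse G.apply_symm_apply
  refine ⟨h.nonwanderingSet_eq ▸ hfin, h.nonwanderingSet_eq ▸ hhyp, fun x => ⟨?_, ?_⟩, ?_⟩
  · obtain ⟨p, hp, hlim⟩ := h.exists_tendsto hfin x
    exact omegaLimitSet_eq_singleton hlim ▸ isPeriodicOrbit_singleton hp
  · obtain ⟨p, hp, hlim⟩ := hinv.exists_tendsto (hfin.subset fun p => hfix) x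
    exact omegaLimitSet_eq_singleton hlim ▸ isPeriodicOrbit_singleton (hfix hp)
  · intro p hp q hq x hx
    have hp := h.isFixedPt_of_mem_periodicPts hp
    have hq := h.isFixedPt_of_mem_periodicPts hq
    rcases lt_or_ge (V p) (V q) with hV | hV
    · exact hlt p hp q hq hV x hx
    · obtain ⟨rfl, rfl⟩ := h.eq_of_le_of_tendsto hinv ((mem_stableSet_iff_of_isFixedPt hp).1 hx.1)
        ((mem_stableSet_iff_of_isFixedPt (hq.to_leftInverse G.symm_apply_apply)).1 hx.2) hV
      exact hself x hp

end Differentiable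

theorem sup_eq_top_of_mem_of_det_ne_zero {S T : Submodule ℝ (ℝ × ℝ)} {u w : ℝ × ℝ} (hu : u ∈ S)
    (hw : w ∈ T) (hdet : u.1 * w.2 - u.2 * w.1 ≠ 0) : S ⊔ T = ⊤ := by
  refine eq_top_iff.2 fun v _ => Submodule.mem_sup.2 ?_
  -- Cramer's rule
  set d := u.1 * w.2 - u.2 * w.1 with hd
  refine ⟨_, S.smul_mem ((v.1 * w.2 - v.2 * w.1) / d) hu, _,
    T.smul_mem ((u.1 * v.2 - u.2 * v.1) / d) hw, ?_⟩
  ext <;> simp only [Prod.fst_add, Prod.snd_add, Prod.smul_fst, Prod.smul_snd, smul_eq_mul]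
  all_goals field_simp; rw [hd]; ring

/-! ### Diffeomorphisms and coverings -/

section Antilipschitz

variable {E : Type*} [NormedAddCommGroup E] [NormedSpace ℝ E] {F : E → E} {K : NNReal}

theorem norm_le_mul_norm_of_antilipschitzWith (hK : AntilipschitzWith K F) {A : E →L[ℝ] E} {z : E}
    (hA : HasFDerivAt F A z) (v : E) : ‖v‖ ≤ K * ‖A v‖ := by
  refine ge_of_tendsto ((hA.lim_real v).norm.const_mul (K : ℝ)) ?_
  filter_upwards [eventually_gt_atTop 0] with c hc
  calc ‖v‖ = c * ‖z + c⁻¹ • v - z‖ := by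
        rw [add_sub_cancel_left, norm_smul, norm_inv, Real.norm_of_nonneg hc.le,
          mul_inv_cancel_left₀ hc.ne']
    _ ≤ c * (K * ‖F (z + c⁻¹ • v) - F z‖) := by
        gcongr
        simpa only [dist_eq_norm] using hK.le_mul_dist (z + c⁻¹ • v) z
    _ = K * ‖c • (F (z + c⁻¹ • v) - F z)‖ := by
        rw [norm_smul, Real.norm_of_nonneg hc.le, mul_left_comm]

variable [FiniteDimensional ℝ E] (hK : AntilipschitzWith K F)
include hK

theorem isClosed_range_of_antilipschitzWith (hF : Continuous F) : IsClosed (range F) := by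
  have : ProperSpace E := FiniteDimensional.proper ℝ E
  have hproper : IsProperMap F := isProperMap_iff_tendsto_cocompact.2
    ⟨hF, by simpa only [Metric.cobounded_eq_cocompact] using hK.tendsto_cobounded⟩
  exact hproper.isClosedMap.isClosed_range

variable {n : WithTop ℕ∞} (hF : ContDiff ℝ n F) (hn : n ≠ 0)
include hF hn

theorem exists_hasFDerivAt_equiv_of_antilipschitzWith (z : E) :
    ∃ A : E ≃L[ℝ] E, HasFDerivAt F (A : E →L[ℝ] E) z := by
  have hA := (hF.differentiable hn z).hasFDerivAt
  have hinj : Injective (fderiv ℝ F z) := (injective_iff_map_eq_zero _).2 fun v hv => by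
    simpa [hv] using norm_le_mul_norm_of_antilipschitzWith hK hA v
  exact ⟨(LinearEquiv.ofInjectiveEndo (fderiv ℝ F z).toLinearMap hinj).toContinuousLinearEquiv, hA⟩

theorem isOpenMap_of_antilipschitzWith : IsOpenMap F := isOpenMap_iff_nhds_le.2 fun z => by
  have : CompleteSpace E := FiniteDimensional.complete ℝ E
  obtain ⟨A, hA⟩ := exists_hasFDerivAt_equiv_of_antilipschitzWith hK hF hn z
  exact ((hF.contDiffAt.hasStrictFDerivAt' hA hn).map_nhds_eq_of_equiv).ge

theorem bijective_of_antilipschitzWith : Bijective F :=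
  ⟨hK.injective, range_eq_univ.1 (IsClopen.eq_univ
    ⟨isClosed_range_of_antilipschitzWith hK hF.continuous,
      (isOpenMap_of_antilipschitzWith hK hF hn).isOpen_range⟩ (range_nonempty F))⟩

omit hK hF hn in
/-- A `C^n` map of a finite dimensional space which does not contract distances by more than a
constant factor, as a diffeomorphism: its derivatives are injective, hence invertible, and its range
is open and closed. -/
noncomputable def diffeomorphOfAntilipschitzWith (hK : AntilipschitzWith K F) (hF : ContDiff ℝ n F)
    (hn : n ≠ 0) : E ≃ₘ^n⟮𝓘(ℝ, E), 𝓘(ℝ, E)⟯ E where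
  toEquiv := Equiv.ofBijective F (bijective_of_antilipschitzWith hK hF hn)
  contMDiff_toFun := hF.contMDiff
  contMDiff_invFun := by
    have : CompleteSpace E := FiniteDimensional.complete ℝ E
    choose A hA using exists_hasFDerivAt_equiv_of_antilipschitzWith hK hF hn
    let e := (Equiv.ofBijective F
      (bijective_of_antilipschitzWith hK hF hn)).toHomeomorphOfContinuousOpen
        hF.continuous (isOpenMap_of_antilipschitzWith hK hF hn)
    exact (e.contDiff_symm hA hF).contMDiff

end Antilipschitz

section Descent

variable {E : Type*} [NormedAddCommGroup E] [NormedSpace ℝ E]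
  {H : Type*} [TopologicalSpace H] {I : ModelWithCorners ℝ E H}
  {M : Type*} [TopologicalSpace M] [ChartedSpace H M]
  {E' : Type*} [NormedAddCommGroup E'] [NormedSpace ℝ E']
  {H' : Type*} [TopologicalSpace H'] {J : ModelWithCorners ℝ E' H'}
  {N : Type*} [TopologicalSpace N] [ChartedSpace H' N]
  {n : WithTop ℕ∞} {L : N → M} {f : M → M}

theorem contMDiff_of_semiconj {F : N → N} (hL : IsLocalDiffeomorph J I n L) (hLs : Surjective L)
    (hF : ContMDiff J J n F) (hf : Semiconj L F f) : ContMDiff I I n f := by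
  intro w
  obtain ⟨z, rfl⟩ := hLs w
  have hlift : ContMDiffAt I I n ((L ∘ F) ∘ (hL z).localInverse) (L z) :=
    ((hL.contMDiff.comp hF).contMDiffAt).comp _ (hL z).localInverse_contMDiffAt
  refine hlift.congr_of_eventuallyEq ?_
  filter_upwards [(hL z).localInverse_eventuallyEq_right] with y hy
  rw [hf.comp_eq, comp_apply, comp_apply]
  exact congrArg f hy.symm

/-- The diffeomorphism that an injective map of the base of a covering induces, when it lifts to a
diffeomorphism of the total space. -/
noncomputable def diffeomorphOfSemiconj {e : N ≃ₘ^n⟮J, J⟯ N} (hL : IsLocalDiffeomorph J I n L)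
    (hLs : Surjective L) (hf : Semiconj L e f) (hinj : Injective f) : M ≃ₘ^n⟮I, I⟯ M where
  toEquiv := Equiv.ofBijective f
    ⟨hinj, Surjective.of_comp (g := L) (hf.comp_eq ▸ hLs.comp e.surjective)⟩
  contMDiff_toFun := contMDiff_of_semiconj hL hLs e.contMDiff hf
  contMDiff_invFun := contMDiff_of_semiconj hL hLs e.symm.contMDiff
    (hf.inverses_right e.apply_symm_apply (Equiv.ofBijective f _).symm_apply_apply)

end Descent

namespace AddCircleManifold

variable (p : ℝ) [hp : Fact (0 < p)]

theorem contMDiff_coe (n : WithTop ℕ∞) :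
    ContMDiff 𝓘(ℝ, ℝ) 𝓘(ℝ, ℝ) n ((↑) : ℝ → AddCircle p) := by
  intro t
  have hmem : (AddCircle.openPartialHomeomorphCoe p (t - p / 2)).symm ∈
      IsManifold.maximalAtlas 𝓘(ℝ, ℝ) n (AddCircle p) :=
    IsManifold.subset_maximalAtlas (mem_range_self _)
  have hpos := hp.out
  exact contMDiffAt_symm_of_mem_maximalAtlas (x := t) hmem
    (show t ∈ Ioo (t - p / 2) (t - p / 2 + p) from ⟨by linarith, by linarith⟩)

theorem contMDiffOn_openPartialHomeomorphCoe_symm (n : WithTop ℕ∞) (c : ℝ) :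
    ContMDiffOn 𝓘(ℝ, ℝ) 𝓘(ℝ, ℝ) n (AddCircle.openPartialHomeomorphCoe p c).symm
      (AddCircle.openPartialHomeomorphCoe p c).target :=
  contMDiffOn_of_mem_maximalAtlas (IsManifold.subset_maximalAtlas (mem_range_self c))

theorem hasMFDerivAt_coe (t : ℝ) :
    HasMFDerivAt 𝓘(ℝ, ℝ) 𝓘(ℝ, ℝ) ((↑) : ℝ → AddCircle p) t (ContinuousLinearMap.id ℝ ℝ) := by
  refine ⟨(AddCircle.continuous_mk' p).continuousAt, ?_⟩
  let e := AddCircle.openPartialHomeomorphCoe p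
    ((AddCircle.equivIco p 0 (t : AddCircle p) : ℝ) - p / 2)
  have hchart : (t : AddCircle p) ∈ e.target := mem_chart_source ℝ (t : AddCircle p)
  let s : ℝ := e.symm (t : AddCircle p)
  have hs : s ∈ e.source := e.map_target hchart
  have hst : (s : AddCircle p) = t := e.right_inv hchart
  -- Read in the preferred chart at its image, the projection is a translation near `t`.
  have htrans : writtenInExtChartAt 𝓘(ℝ, ℝ) 𝓘(ℝ, ℝ) t ((↑) : ℝ → AddCircle p) =ᶠ[𝓝 t]
      fun u : ℝ => u + (s - t) := by
    have hcont : ContinuousAt (fun u : ℝ => u + (s - t)) t := by fun_prop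
    have hev : ∀ᶠ u in 𝓝 t, u + (s - t) ∈ e.source :=
      hcont.eventually (e.open_source.mem_nhds (by simpa using hs))
    filter_upwards [hev] with u hu
    have hcoe : ((u + (s - t) : ℝ) : AddCircle p) = u := by
      rw [AddCircle.coe_add, AddCircle.coe_sub, hst, sub_self, add_zero]
    have hleft : e.symm ((u + (s - t) : ℝ) : AddCircle p) = u + (s - t) := e.left_inv hu
    rwa [hcoe] at hleft
  have hd : HasFDerivAt (fun u : ℝ => u + (s - t)) (ContinuousLinearMap.id ℝ ℝ) t :=
    (hasFDerivAt_id t).add_const _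
  exact (hd.congr_of_eventuallyEq htrans).hasFDerivWithinAt (s := range 𝓘(ℝ, ℝ))

end AddCircleManifold

/-- The universal covering of the torus by the plane. -/
noncomputable def torusProj (z : ℝ × ℝ) : Torus := torusPt z.1 z.2

theorem torusProj_surjective : Surjective torusProj :=
  Surjective.prodMap QuotientAddGroup.mk_surjective QuotientAddGroup.mk_surjective

theorem torusProj_eq_iff {z w : ℝ × ℝ} : torusProj z = torusProj w ↔
    ∃ m n : ℤ, z = w + (m * (2 * π), n * (2 * π)) := by
  have hcircle : ∀ s t : ℝ, (s : AddCircle (2 * π)) = t ↔ ∃ m : ℤ, s = t + m * (2 * π) := by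
    intro s t
    rw [← sub_eq_zero, ← AddCircle.coe_sub, AddCircle.coe_eq_zero_iff]
    simp only [zsmul_eq_mul, eq_sub_iff_add_eq', eq_comm (a := s)]
  simp only [torusProj, torusPt, Prod.ext_iff, hcircle, Prod.fst_add, Prod.snd_add,
    exists_and_left, exists_and_right]

theorem contMDiff_torusProj : ContMDiff 𝓘(ℝ, ℝ × ℝ) torusModel 1 torusProj :=
  ((AddCircleManifold.contMDiff_coe _ 1).comp contDiff_fst.contMDiff).prodMk
    ((AddCircleManifold.contMDiff_coe _ 1).comp contDiff_snd.contMDiff)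

theorem isLocalDiffeomorph_torusProj : IsLocalDiffeomorph 𝓘(ℝ, ℝ × ℝ) torusModel 1 torusProj := by
  intro z
  let e (t : ℝ) := AddCircle.openPartialHomeomorphCoe (2 * π) (t - π)
  have hmem (t : ℝ) : t ∈ (e t).source :=
    show t ∈ Ioo (t - π) (t - π + 2 * π) from ⟨by linarith [Real.pi_pos], by linarith [Real.pi_pos]⟩
  have hsymm (t : ℝ) : ContMDiffOn 𝓘(ℝ, ℝ) 𝓘(ℝ, ℝ) 1 (e t).symm (e t).target :=
    AddCircleManifold.contMDiffOn_openPartialHomeomorphCoe_symm _ 1 _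
  refine ⟨⟨(e z.1).toPartialEquiv.prod (e z.2).toPartialEquiv,
    (e z.1).open_source.prod (e z.2).open_source, (e z.1).open_target.prod (e z.2).open_target,
    contMDiff_torusProj.contMDiffOn, ?_⟩, ⟨hmem z.1, hmem z.2⟩, fun _ _ => rfl⟩
  exact ((hsymm z.1).comp contMDiffOn_fst fun _ hw => hw.1).prodMk_space
    ((hsymm z.2).comp contMDiffOn_snd fun _ hw => hw.2)

theorem hasMFDerivAt_torusProj (z : ℝ × ℝ) :
    HasMFDerivAt 𝓘(ℝ, ℝ × ℝ) torusModel torusProj z (ContinuousLinearMap.id ℝ (ℝ × ℝ)) := by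
  have hfst := (AddCircleManifold.hasMFDerivAt_coe (2 * π) z.1).comp z
    (hasFDerivAt_fst (𝕜 := ℝ) (E := ℝ) (F := ℝ) (p := z)).hasMFDerivAt
  have hsnd := (AddCircleManifold.hasMFDerivAt_coe (2 * π) z.2).comp z
    (hasFDerivAt_snd (𝕜 := ℝ) (E := ℝ) (F := ℝ) (p := z)).hasMFDerivAt
  exact hfst.prodMk hsnd

section Lift

variable {F : ℝ × ℝ → ℝ × ℝ} {f : Torus → Torus} {z : ℝ × ℝ}

theorem returnDeriv_of_semiconj (hF : ContDiff ℝ 1 F) (hf : Semiconj torusProj F f)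
    (hz : F z = z) {A : ℝ × ℝ →L[ℝ] ℝ × ℝ} (hA : HasFDerivAt F A z) :
    returnDeriv torusModel f (torusProj z) = A := by
  have hfix : IsFixedPt f (torusProj z) := (hf.eq z).symm.trans (congrArg torusProj hz)
  rw [returnDeriv, returnMap_of_isFixedPt hfix]
  have hfd : HasMFDerivAt torusModel torusModel f (torusProj z)
      (mfderiv torusModel torusModel f (torusProj z)) :=
    ((contMDiff_of_semiconj isLocalDiffeomorph_torusProj torusProj_surjective hF.contMDiff
      hf).mdifferentiableAt one_ne_zero).hasMFDerivAt
  have hdown := hfd.comp z (hasMFDerivAt_torusProj z)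
  rw [← hf.comp_eq] at hdown
  have hup := (hasMFDerivAt_torusProj (F z)).comp z hA.hasMFDerivAt
  have heq := hasMFDerivAt_unique hdown hup
  exact heq

/- An orbit converging to an attracting point enters a neighbourhood of it that is attracted
uniformly, so a neighbourhood of its starting point is attracted uniformly too. -/
theorem stableTangent_eq_top_of_semiconj (hfc : Continuous f) (hf : Semiconj torusProj F f)
    (hz : F z = z) (hatt : ∃ U ∈ 𝓝 z, AttractsUniformlyOn F z U) {x : Torus}
    (hx : x ∈ stableSet f (torusProj z)) : stableTangent torusModel f (torusProj z) x = ⊤ := by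
  have hfix : IsFixedPt f (torusProj z) := (hf.eq z).symm.trans (congrArg torusProj hz)
  obtain ⟨U, hU, hattU⟩ := hatt
  have himage : torusProj '' U ∈ 𝓝 (torusProj z) :=
    isLocalDiffeomorph_torusProj.isOpenMap.image_mem_nhds hU
  obtain ⟨W, hW, hattW⟩ := (hattU.image hf contMDiff_torusProj.continuous.continuousAt
    ).exists_mem_nhds_of_tendsto hfc himage ((mem_stableSet_iff_of_isFixedPt hfix).1 hx)
  obtain ⟨y, rfl⟩ := torusProj_surjective x
  refine eq_top_iff.2 fun v _ => ?_
  have hv := mfderiv_mem_stableTangent contMDiff_torusProj hfix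
    (contMDiff_torusProj.continuous.continuousAt.preimage_mem_nhds hW)
    (hattW.mono (image_preimage_subset _ _)) v
  rwa [(hasMFDerivAt_torusProj y).mfderiv] at hv

theorem mem_stableTangent_of_semiconj_line {h : ℝ → ℝ} {u : ℝ × ℝ}
    (hf : Semiconj (fun t : ℝ => torusProj (z + t • u)) h f) (h0 : h 0 = 0)
    (hatt : ∃ U ∈ 𝓝 0, AttractsUniformlyOn h 0 U) :
    u ∈ stableTangent torusModel f (torusProj z) (torusProj z) := by
  let L (t : ℝ) : Torus := torusProj (z + t • u)
  have hL : ContMDiff 𝓘(ℝ, ℝ) torusModel 1 L :=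
    contMDiff_torusProj.comp (show ContDiff ℝ 1 fun t : ℝ => z + t • u by fun_prop).contMDiff
  have hL0 : L 0 = torusProj z := by simp [L]
  have hfix : IsFixedPt f (L 0) := (hf.eq 0).symm.trans (congrArg L h0)
  obtain ⟨U, hU, hattU⟩ := hatt
  have hline : HasDerivAt (fun t : ℝ => z + t • u) u 0 := by
    simpa using ((hasDerivAt_id (0 : ℝ)).smul_const u).const_add z
  have hder : (mfderiv 𝓘(ℝ, ℝ) torusModel L 0 (1 : ℝ) : ℝ × ℝ) = u := by
    refine (mfderiv_comp_apply_one
      (contMDiff_torusProj.mdifferentiableAt one_ne_zero) hline).trans ?_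
    rw [(hasMFDerivAt_torusProj _).mfderiv]
    rfl
  have hmem : (mfderiv 𝓘(ℝ, ℝ) torusModel L 0 (1 : ℝ) : ℝ × ℝ) ∈
      stableTangent torusModel f (L 0) (L 0) :=
    mfderiv_mem_stableTangent hL hfix hU (hattU.image hf hL.continuous.continuousAt) 1
  rwa [hder, hL0] at hmem

end Lift

/-! ### The lift to the plane -/

/-- Minus the gradient of the potential `cos x + cos y + cos (x - y)`. -/
noncomputable def syncForce (z : ℝ × ℝ) : ℝ × ℝ :=
  (Real.sin z.1 + Real.sin (z.1 - z.2), Real.sin z.2 - Real.sin (z.1 - z.2))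

/-- The lift of `syncMap a` to the plane. It is a gradient step, preconditioned by the matrix with
rows `(2, 1)` and `(1, 2)`. -/
noncomputable def syncLift (a : ℝ) (z : ℝ × ℝ) : ℝ × ℝ :=
  z + a • (2 * (syncForce z).1 + (syncForce z).2, (syncForce z).1 + 2 * (syncForce z).2)

theorem semiconj_syncLift (a : ℝ) : Semiconj torusProj (syncLift a) (syncMap a) := fun z => by
  have hsin : Real.sin (z.2 - z.1) = -Real.sin (z.1 - z.2) := by rw [← Real.sin_neg, neg_sub]
  rw [torusProj, torusProj, syncMap_torusPt, hsin]
  congr 1 <;> simp only [syncLift, syncForce, Prod.fst_add, Prod.snd_add, Prod.smul_fst,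
    Prod.smul_snd, smul_eq_mul] <;> ring

theorem contDiff_syncLift (a : ℝ) : ContDiff ℝ 1 (syncLift a) := by
  unfold syncLift syncForce
  fun_prop

theorem syncForce_add_periods (z : ℝ × ℝ) (m n : ℤ) :
    syncForce (z + (m * (2 * π), n * (2 * π))) = syncForce z := by
  have hsub : z.1 + m * (2 * π) - (z.2 + n * (2 * π)) = z.1 - z.2 + (m - n : ℤ) * (2 * π) := by
    push_cast
    ring
  simp only [syncForce, Prod.fst_add, Prod.snd_add, hsub, Real.sin_add_int_mul_two_pi]

theorem syncLift_add_periods (a : ℝ) (z : ℝ × ℝ) (m n : ℤ) :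
    syncLift a (z + (m * (2 * π), n * (2 * π))) = syncLift a z + (m * (2 * π), n * (2 * π)) := by
  rw [syncLift, syncForce_add_periods, syncLift, add_right_comm]

theorem syncLift_eq_self (a : ℝ) {z : ℝ × ℝ} (hz : syncForce z = 0) : syncLift a z = z := by
  simp only [syncLift, hz, Prod.fst_zero, Prod.snd_zero, mul_zero, add_zero, Prod.mk_zero_zero,
    smul_zero]

/-- The derivative of `syncLift a` at a point where `α`, `β`, `γ` are the cosines of `x`, `y` and
`x - y`. -/
noncomputable def couplingMap (a α β γ : ℝ) : ℝ × ℝ →L[ℝ] ℝ × ℝ :=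
  ((1 + a * (2 * α + γ)) • ContinuousLinearMap.fst ℝ ℝ ℝ +
      (a * (β - γ)) • ContinuousLinearMap.snd ℝ ℝ ℝ).prod
    ((a * (α - γ)) • ContinuousLinearMap.fst ℝ ℝ ℝ +
      (1 + a * (2 * β + γ)) • ContinuousLinearMap.snd ℝ ℝ ℝ)

theorem couplingMap_apply (a α β γ : ℝ) (v : ℝ × ℝ) : couplingMap a α β γ v =
    ((1 + a * (2 * α + γ)) * v.1 + a * (β - γ) * v.2,
      a * (α - γ) * v.1 + (1 + a * (2 * β + γ)) * v.2) := rfl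

theorem couplingMap_self (a c : ℝ) :
    couplingMap a c c c = (1 + 3 * a * c) • ContinuousLinearMap.id ℝ (ℝ × ℝ) := by
  refine ContinuousLinearMap.ext fun v => ?_
  rw [couplingMap_apply]
  ext <;> simp only [smul_apply, ContinuousLinearMap.id_apply, Prod.smul_fst, Prod.smul_snd,
    smul_eq_mul] <;> ring

theorem hasFDerivAt_syncLift (a : ℝ) (z : ℝ × ℝ) : HasFDerivAt (syncLift a)
    (couplingMap a (Real.cos z.1) (Real.cos z.2) (Real.cos (z.1 - z.2))) z := by
  have hx : HasFDerivAt (fun z : ℝ × ℝ => z.1) (ContinuousLinearMap.fst ℝ ℝ ℝ) z := hasFDerivAt_fst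
  have hy : HasFDerivAt (fun z : ℝ × ℝ => z.2) (ContinuousLinearMap.snd ℝ ℝ ℝ) z := hasFDerivAt_snd
  have hp := hx.sin.add (hx.sub hy).sin
  have hq := hy.sin.sub (hx.sub hy).sin
  refine ((hasFDerivAt_id z).add ((((hp.const_mul 2).add hq).prodMk
    (hp.add (hq.const_mul 2))).const_smul a)).congr_fderiv (ContinuousLinearMap.ext fun v => ?_)
  rw [couplingMap_apply]
  ext <;> simp only [ContinuousLinearMap.prod_apply, ContinuousLinearMap.id_apply, add_apply,
    smul_apply, sub_apply, ContinuousLinearMap.coe_fst', ContinuousLinearMap.coe_snd',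
    Pi.sub_apply, Prod.fst_add, Prod.snd_add, Prod.smul_fst, Prod.smul_snd, smul_eq_mul] <;> ring

/-- The norm of the plane whose unit ball is the hexagon cut out by the three directions in which
the sines of the synchronisation map act. -/
noncomputable def hexNorm : Seminorm ℝ (ℝ × ℝ) :=
  normSeminorm ℝ (ℝ × ℝ) ⊔ (normSeminorm ℝ ℝ).comp (LinearMap.fst ℝ ℝ ℝ - LinearMap.snd ℝ ℝ ℝ)

theorem hexNorm_apply (d : ℝ × ℝ) : hexNorm d = max ‖d‖ |d.1 - d.2| := rfl

theorem two_mul_hexNorm (d : ℝ × ℝ) : 2 * hexNorm d = |d.1| + |d.2| + |d.1 - d.2| := by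
  rw [hexNorm_apply, Prod.norm_def, Real.norm_eq_abs, Real.norm_eq_abs]
  grind

theorem hexNorm_le_iff {d : ℝ × ℝ} {r : ℝ} :
    hexNorm d ≤ r ↔ |d.1| ≤ r ∧ |d.2| ≤ r ∧ |d.1 - d.2| ≤ r := by
  rw [hexNorm_apply, max_le_iff, norm_prod_le_iff, Real.norm_eq_abs, Real.norm_eq_abs, and_assoc]

theorem hexNorm_coupling_le {d : ℝ × ℝ} {s t u : ℝ} (hs : |s| ≤ |d.1|) (ht : |t| ≤ |d.2|)
    (hu : |u| ≤ |d.1 - d.2|) : hexNorm (2 * s + t + u, s + 2 * t - u) ≤ 3 * hexNorm d := by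
  have hmax := hexNorm_le_iff.1 (le_refl (hexNorm d))
  rw [hexNorm_le_iff]
  grind [two_mul_hexNorm d]

theorem hexNorm_le_two_mul_norm (d : ℝ × ℝ) : hexNorm d ≤ 2 * ‖d‖ := by
  rw [hexNorm_apply]
  exact max_le (by linarith [norm_nonneg d])
    ((norm_sub_le d.1 d.2).trans (by linarith [norm_fst_le d, norm_snd_le d]))

theorem abs_sin_sub_sin_le (x y : ℝ) : |Real.sin x - Real.sin y| ≤ |x - y| := by
  simpa [Real.dist_eq] using Real.lipschitzWith_sin.dist_le_mul x y

section Diffeomorph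

variable {a : ℝ} (ha : 0 < a) (ha' : a < 1 / 3)
include ha

theorem hexNorm_sub_le (z w : ℝ × ℝ) :
    (1 - 3 * a) * hexNorm (z - w) ≤ 2 * ‖syncLift a z - syncLift a w‖ := by
  set e := syncLift a z - syncLift a w with he
  set s := Real.sin z.1 - Real.sin w.1 with hs
  set t := Real.sin z.2 - Real.sin w.2 with ht
  set u := Real.sin (z.1 - z.2) - Real.sin (w.1 - w.2) with hu
  have hd : z - w = e - a • (2 * s + t + u, s + 2 * t - u) := by
    ext <;> simp only [he, hs, ht, hu, syncLift, syncForce, Prod.fst_sub, Prod.snd_sub,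
      Prod.fst_add, Prod.snd_add, Prod.smul_fst, Prod.smul_snd, smul_eq_mul] <;> ring
  have hpert : hexNorm (2 * s + t + u, s + 2 * t - u) ≤ 3 * hexNorm (z - w) := by
    refine hexNorm_coupling_le (abs_sin_sub_sin_le _ _) (abs_sin_sub_sin_le _ _) ?_
    rw [Prod.fst_sub, Prod.snd_sub, sub_sub_sub_comm]
    exact abs_sin_sub_sin_le _ _
  have hle : hexNorm (z - w) ≤ 2 * ‖e‖ + a * (3 * hexNorm (z - w)) :=
    calc hexNorm (z - w) ≤ hexNorm e + hexNorm (a • (2 * s + t + u, s + 2 * t - u)) :=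
          hd ▸ map_sub_le_add hexNorm _ _
      _ = hexNorm e + a * hexNorm (2 * s + t + u, s + 2 * t - u) := by
          rw [map_smul_eq_mul, Real.norm_of_nonneg ha.le]
      _ ≤ 2 * ‖e‖ + a * (3 * hexNorm (z - w)) := by
          gcongr
          exact hexNorm_le_two_mul_norm e
  linarith

include ha'

theorem antilipschitzWith_syncLift :
    AntilipschitzWith (2 / (1 - 3 * a)).toNNReal (syncLift a) := by
  have hpos : 0 < 1 - 3 * a := by linarith
  refine AntilipschitzWith.of_le_mul_dist fun z w => ?_
  rw [dist_eq_norm, dist_eq_norm, Real.coe_toNNReal _ (by positivity), div_mul_eq_mul_div,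
    le_div_iff₀' hpos]
  refine le_trans ?_ (hexNorm_sub_le ha z w)
  gcongr
  exact le_max_left _ _

theorem injective_syncMap : Injective (syncMap a) := fun x y hxy => by
  obtain ⟨z, rfl⟩ := torusProj_surjective x
  obtain ⟨w, rfl⟩ := torusProj_surjective y
  rw [← (semiconj_syncLift a).eq, ← (semiconj_syncLift a).eq, torusProj_eq_iff] at hxy
  obtain ⟨m, n, hmn⟩ := hxy
  rw [← syncLift_add_periods] at hmn
  exact torusProj_eq_iff.2 ⟨m, n, (antilipschitzWith_syncLift ha ha').injective hmn⟩

omit ha ha'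

/-- `syncLift a` as a diffeomorphism of the plane. -/
noncomputable def syncLiftDiffeo (ha : 0 < a) (ha' : a < 1 / 3) :
    (ℝ × ℝ) ≃ₘ^1⟮𝓘(ℝ, ℝ × ℝ), 𝓘(ℝ, ℝ × ℝ)⟯ (ℝ × ℝ) :=
  diffeomorphOfAntilipschitzWith (antilipschitzWith_syncLift ha ha') (contDiff_syncLift a)
    one_ne_zero

/-- `syncMap a` as a diffeomorphism of the torus. -/
noncomputable def syncDiffeo (ha : 0 < a) (ha' : a < 1 / 3) :
    Torus ≃ₘ^1⟮torusModel, torusModel⟯ Torus :=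
  diffeomorphOfSemiconj (e := syncLiftDiffeo ha ha') isLocalDiffeomorph_torusProj
    torusProj_surjective (semiconj_syncLift a) (injective_syncMap ha ha')

theorem semiconj_syncLiftDiffeo_symm (ha : 0 < a) (ha' : a < 1 / 3) :
    Semiconj torusProj (syncLiftDiffeo ha ha').symm (syncDiffeo ha ha').symm :=
  (semiconj_syncLift a).inverses_right (syncLiftDiffeo ha ha').apply_symm_apply
    (syncDiffeo ha ha').symm_apply_apply

end Diffeomorph

/-- The map that `syncLift a` induces on the stable lines through its saddles. -/
noncomputable def stableLineMap (a t : ℝ) : ℝ := t - 3 * a * Real.sin t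

/-- The map that `syncLift a` induces on the unstable lines through its saddles. -/
noncomputable def unstableLineMap (a t : ℝ) : ℝ := t + a * (Real.sin (2 * t) - Real.sin t)

theorem antilipschitzWith_unstableLineMap {a : ℝ} (ha : 0 < a) (ha' : a < 1 / 3) :
    AntilipschitzWith (1 / (1 - 3 * a)).toNNReal (unstableLineMap a) := by
  have hpos : 0 < 1 - 3 * a := by linarith
  refine AntilipschitzWith.of_le_mul_dist fun t s => ?_
  rw [Real.dist_eq, Real.dist_eq, Real.coe_toNNReal _ (by positivity), div_mul_eq_mul_div,
    le_div_iff₀' hpos, one_mul]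
  have hdouble : |Real.sin (2 * t) - Real.sin (2 * s)| ≤ 2 * |t - s| := by
    simpa [← mul_sub, abs_mul] using abs_sin_sub_sin_le (2 * t) (2 * s)
  have hpert : |Real.sin (2 * t) - Real.sin (2 * s) - (Real.sin t - Real.sin s)| ≤ 3 * |t - s| :=
    (abs_sub _ _).trans (by linarith [abs_sin_sub_sin_le t s])
  calc (1 - 3 * a) * |t - s| = |t - s| - a * (3 * |t - s|) := by ring
    _ ≤ |t - s| - a * |Real.sin (2 * t) - Real.sin (2 * s) - (Real.sin t - Real.sin s)| := by
        gcongr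
    _ = |t - s| - |a * (Real.sin (2 * t) - Real.sin (2 * s) - (Real.sin t - Real.sin s))| := by
        rw [abs_mul, abs_of_pos ha]
    _ ≤ |t - s + a * (Real.sin (2 * t) - Real.sin (2 * s) - (Real.sin t - Real.sin s))| :=
        abs_sub_abs_le_abs_add _ _
    _ = |unstableLineMap a t - unstableLineMap a s| := by
        rw [unstableLineMap, unstableLineMap]
        ring_nf

/-- `unstableLineMap a` as a diffeomorphism of the line. -/
noncomputable def unstableLineDiffeo {a : ℝ} (ha : 0 < a) (ha' : a < 1 / 3) :
    ℝ ≃ₘ^1⟮𝓘(ℝ, ℝ), 𝓘(ℝ, ℝ)⟯ ℝ :=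
  diffeomorphOfAntilipschitzWith (antilipschitzWith_unstableLineMap ha ha')
    (show ContDiff ℝ 1 fun t : ℝ => t + a * (Real.sin (2 * t) - Real.sin t) by fun_prop) one_ne_zero

/-! ### Fixed points and their types -/

theorem cos_add_le (x h : ℝ) :
    Real.cos (x + h) ≤ Real.cos x - h * Real.sin x + h ^ 2 / 2 := by
  set ψ : ℝ → ℝ := fun t => t ^ 2 / 2 - Real.cos t with hψ
  have hd (t : ℝ) : HasDerivAt ψ (t + Real.sin t) t :=
    (((hasDerivAt_pow 2 t).div_const 2).sub (Real.hasDerivAt_cos t)).congr_deriv (by norm_num)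
  have hmono : Monotone (deriv ψ) := fun s t hst => by
    rw [(hd s).deriv, (hd t).deriv]
    have := (le_abs_self _).trans (abs_sin_sub_sin_le s t)
    rw [abs_of_nonpos (sub_nonpos.2 hst)] at this
    linarith
  have hconv : ConvexOn ℝ univ ψ :=
    hmono.convexOn_univ_of_deriv fun t => (hd t).differentiableAt
  have htangent : ψ x + (x + Real.sin x) * h ≤ ψ (x + h) := by
    rcases lt_trichotomy h 0 with hh | rfl | hh
    · have := hconv.slope_le_of_hasDerivAt (mem_univ (x + h)) (mem_univ x) (by linarith) (hd x)
      rw [slope_def_field, div_le_iff₀ (by linarith)] at this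
      linarith
    · simp
    · have := hconv.le_slope_of_hasDerivAt (mem_univ x) (mem_univ (x + h)) (by linarith) (hd x)
      rw [slope_def_field, le_div_iff₀ (by linarith)] at this
      linarith
  simp only [hψ] at htangent
  linarith

/-- The cosine function on `ℝ / 2πℤ`. -/
noncomputable def circleCos : AddCircle (2 * π) → ℝ := Real.cos_periodic.lift

theorem circleCos_coe (t : ℝ) : circleCos (t : AddCircle (2 * π)) = Real.cos t :=
  Periodic.lift_coe _ t

theorem continuous_circleCos : Continuous circleCos :=
  Real.Angle.continuous_cos

/-- The potential on the torus whose gradient is minus `syncForce`. -/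
noncomputable def syncPotential (w : Torus) : ℝ :=
  circleCos w.1 + circleCos w.2 + circleCos (w.1 - w.2)

theorem syncPotential_torusProj (z : ℝ × ℝ) :
    syncPotential (torusProj z) = Real.cos z.1 + Real.cos z.2 + Real.cos (z.1 - z.2) := by
  simp only [syncPotential, torusProj, torusPt, ← AddCircle.coe_sub, circleCos_coe]

theorem continuous_syncPotential : Continuous syncPotential :=
  ((continuous_circleCos.comp continuous_fst).add (continuous_circleCos.comp continuous_snd)).add
    (continuous_circleCos.comp (continuous_fst.sub continuous_snd))

theorem syncPotential_syncMap_le (a : ℝ) (z : ℝ × ℝ) :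
    syncPotential (syncMap a (torusProj z)) ≤ syncPotential (torusProj z) -
      a * (2 - 3 * a) * ((syncForce z).1 ^ 2 + (syncForce z).1 * (syncForce z).2 +
        (syncForce z).2 ^ 2) := by
  rw [← (semiconj_syncLift a).eq, syncPotential_torusProj, syncPotential_torusProj]
  set p := (syncForce z).1 with hp
  set q := (syncForce z).2 with hq
  have hx : (syncLift a z).1 = z.1 + a * (2 * p + q) := rfl
  have hy : (syncLift a z).2 = z.2 + a * (p + 2 * q) := rfl
  have hxy : (syncLift a z).1 - (syncLift a z).2 = z.1 - z.2 + a * (p - q) := by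
    rw [hx, hy]
    ring
  rw [hxy, hx, hy]
  refine (add_le_add (add_le_add (cos_add_le _ _) (cos_add_le _ _)) (cos_add_le _ _)).trans_eq ?_
  simp only [hp, hq, syncForce]
  ring

section Lyapunov

variable {a : ℝ} (ha : 0 < a) (ha' : a < 2 / 3) {z : ℝ × ℝ}
include ha ha'

theorem syncPotential_syncMap_lt (hz : syncForce z ≠ 0) :
    syncPotential (syncMap a (torusProj z)) < syncPotential (torusProj z) := by
  refine (syncPotential_syncMap_le a z).trans_lt (sub_lt_self _ ?_)
  have hquad :
      0 < (syncForce z).1 ^ 2 + (syncForce z).1 * (syncForce z).2 + (syncForce z).2 ^ 2 := by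
    by_contra! hle
    refine hz (Prod.ext (pow_eq_zero_iff two_ne_zero |>.1 ?_) (pow_eq_zero_iff two_ne_zero |>.1 ?_))
    all_goals nlinarith [sq_nonneg ((syncForce z).1 + (syncForce z).2),
      sq_nonneg (syncForce z).1, sq_nonneg (syncForce z).2]
  exact mul_pos (mul_pos ha (by linarith)) hquad

theorem isFixedPt_syncMap_iff : IsFixedPt (syncMap a) (torusProj z) ↔ syncForce z = 0 := by
  refine ⟨fun h => ?_, fun h => ?_⟩
  · by_contra hz
    exact (syncPotential_syncMap_lt ha ha' hz).ne (congrArg syncPotential h)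
  · rw [IsFixedPt, ← (semiconj_syncLift a).eq, syncLift_eq_self a h]

theorem isStrictLyapunov_syncMap : IsStrictLyapunov (syncMap a) syncPotential where
  continuous_map := (contMDiff_of_semiconj isLocalDiffeomorph_torusProj torusProj_surjective
    (contDiff_syncLift a).contMDiff (semiconj_syncLift a)).continuous
  continuous := continuous_syncPotential
  lt_of_not_isFixedPt w hw := by
    obtain ⟨z, rfl⟩ := torusProj_surjective w
    exact syncPotential_syncMap_lt ha ha' (mt (isFixedPt_syncMap_iff ha ha').2 hw)

end Lyapunov

theorem angle_eq_of_three_nsmul_eq_zero {X : Real.Angle} (h : 3 • X = 0) :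
    X = 0 ∨ X = (2 * π / 3 : ℝ) ∨ X = (4 * π / 3 : ℝ) := by
  rw [← nsmul_zero 3, Real.Angle.nsmul_eq_iff three_ne_zero] at h
  obtain ⟨k, rfl⟩ := h
  rw [zero_add, ← Real.Angle.coe_nsmul]
  fin_cases k
  · exact Or.inl (by simp)
  · exact Or.inr (Or.inl (by simp))
  · refine Or.inr (Or.inr (congrArg _ ?_))
    simp only [nsmul_eq_mul]
    push_cast
    ring

theorem angle_nsmul_eq_zero_of_sin_eq {X Y : Real.Angle} (h₁ : X.sin = (-Y).sin)
    (h₂ : Y.sin = (X - Y).sin) :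
    (2 • X = 0 ∧ 2 • Y = 0) ∨ (3 • X = 0 ∧ Y = -X) := by
  have htwo : (2 : ℕ) • (π : Real.Angle) = 0 := Real.Angle.two_nsmul_coe_pi
  rcases Real.Angle.sin_eq_iff_eq_or_add_eq_pi.1 h₁ with h | h
  · obtain rfl : Y = -X := by rw [h, neg_neg]
    rcases Real.Angle.sin_eq_iff_eq_or_add_eq_pi.1 h₂ with h | h
    · refine Or.inr ⟨?_, rfl⟩
      rw [← sub_eq_zero.2 h.symm]
      abel
    · obtain rfl : X = π := by
        rw [← h]
        abel
      exact Or.inl ⟨htwo, by rw [smul_neg, htwo, neg_zero]⟩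
  · obtain rfl : X = π + Y := by rw [← h, neg_add_cancel_right]
    rw [add_sub_cancel_right, Real.Angle.sin_coe_pi, Real.Angle.sin_eq_zero_iff,
      ← Real.Angle.two_nsmul_eq_zero_iff] at h₂
    exact Or.inl ⟨by rw [nsmul_add, htwo, h₂, add_zero], h₂⟩

/-- Representatives in the plane of the saddles of `syncMap a`. -/
def syncSaddles : Set (ℝ × ℝ) := {(0, π), (π, 0), (π, π)}

/-- Representatives in the plane of the sinks of `syncMap a`. -/
def syncSinks : Set (ℝ × ℝ) := {(2 * π / 3, 4 * π / 3), (4 * π / 3, 2 * π / 3)}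

/-- Representatives in the plane of the fixed points of `syncMap a`. -/
def syncFixedPoints : Set (ℝ × ℝ) := insert (0, 0) (syncSaddles ∪ syncSinks)

theorem sin_two_pi_div_three : Real.sin (2 * π / 3) = √3 / 2 := by
  rw [show 2 * π / 3 = π - π / 3 by ring, Real.sin_pi_sub, Real.sin_pi_div_three]

theorem sin_four_pi_div_three : Real.sin (4 * π / 3) = -(√3 / 2) := by
  rw [show 4 * π / 3 = π / 3 + π by ring, Real.sin_add_pi, Real.sin_pi_div_three]

theorem cos_two_pi_div_three : Real.cos (2 * π / 3) = -(1 / 2) := by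
  rw [show 2 * π / 3 = π - π / 3 by ring, Real.cos_pi_sub, Real.cos_pi_div_three]

theorem cos_four_pi_div_three : Real.cos (4 * π / 3) = -(1 / 2) := by
  rw [show 4 * π / 3 = π / 3 + π by ring, Real.cos_add_pi, Real.cos_pi_div_three]

theorem cos_of_mem_syncSinks {z : ℝ × ℝ} (hz : z ∈ syncSinks) :
    Real.cos z.1 = -(1 / 2) ∧ Real.cos z.2 = -(1 / 2) ∧ Real.cos (z.1 - z.2) = -(1 / 2) := by
  rcases hz with rfl | rfl
  · refine ⟨cos_two_pi_div_three, cos_four_pi_div_three, ?_⟩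
    rw [show 2 * π / 3 - 4 * π / 3 = -(2 * π / 3) by ring, Real.cos_neg, cos_two_pi_div_three]
  · refine ⟨cos_four_pi_div_three, cos_two_pi_div_three, ?_⟩
    rw [show 4 * π / 3 - 2 * π / 3 = 2 * π / 3 by ring, cos_two_pi_div_three]

theorem syncForce_eq_zero_of_mem {z : ℝ × ℝ} (hz : z ∈ syncFixedPoints) : syncForce z = 0 := by
  rcases hz with rfl | (rfl | rfl | rfl) | rfl | rfl <;>
    simp [syncForce, sin_two_pi_div_three, sin_four_pi_div_three,
      show 2 * π / 3 - 4 * π / 3 = -(2 * π / 3) by ring,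
      show 4 * π / 3 - 2 * π / 3 = 2 * π / 3 by ring]

theorem torusProj_mem_of_syncForce_eq_zero {z : ℝ × ℝ} (hz : syncForce z = 0) :
    torusProj z ∈ torusProj '' syncFixedPoints := by
  obtain ⟨hp, hq⟩ := Prod.ext_iff.1 hz
  have h₁ : Real.Angle.sin z.1 = Real.Angle.sin (-z.2) := by
    rw [← Real.Angle.coe_neg, Real.Angle.sin_coe, Real.Angle.sin_coe, Real.sin_neg]
    exact eq_neg_of_add_eq_zero_left (by simpa [syncForce] using congrArg₂ (· + ·) hp hq)
  have h₂ : Real.Angle.sin z.2 = Real.Angle.sin (z.1 - z.2) := by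
    rw [← Real.Angle.coe_sub, Real.Angle.sin_coe, Real.Angle.sin_coe]
    exact sub_eq_zero.1 hq
  have hmem {x y : ℝ} (hxy : (x, y) ∈ syncFixedPoints) (hx : (z.1 : Real.Angle) = x)
      (hy : (z.2 : Real.Angle) = y) : torusProj z ∈ torusProj '' syncFixedPoints :=
    ⟨(x, y), hxy, Prod.ext hx.symm hy.symm⟩
  have hneg : -((2 * π / 3 : ℝ) : Real.Angle) = (4 * π / 3 : ℝ) := by
    rw [neg_eq_iff_add_eq_zero, ← Real.Angle.coe_add, ← Real.Angle.coe_two_pi]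
    ring_nf
  rcases angle_nsmul_eq_zero_of_sin_eq h₁ h₂ with ⟨hX, hY⟩ | ⟨hX, hY⟩
  · rcases Real.Angle.two_nsmul_eq_zero_iff.1 hX with hX | hX <;>
      rcases Real.Angle.two_nsmul_eq_zero_iff.1 hY with hY | hY <;>
      exact hmem (by simp [syncFixedPoints, syncSaddles]) hX hY
  · rcases angle_eq_of_three_nsmul_eq_zero hX with hX | hX | hX
    · exact hmem (Or.inl rfl) hX (by rw [hY, hX, neg_zero, Real.Angle.coe_zero])
    · exact hmem (Or.inr (Or.inr (Or.inl rfl))) hX (by rw [hY, hX, hneg])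
    · exact hmem (Or.inr (Or.inr (Or.inr rfl))) hX (by rw [hY, hX, ← hneg, neg_neg])

theorem fixedPoints_syncMap {a : ℝ} (ha : 0 < a) (ha' : a < 2 / 3) :
    fixedPoints (syncMap a) = torusProj '' syncFixedPoints := by
  refine Subset.antisymm (fun w hw => ?_) ?_
  · obtain ⟨z, rfl⟩ := torusProj_surjective w
    exact torusProj_mem_of_syncForce_eq_zero ((isFixedPt_syncMap_iff ha ha').1 hw)
  · rintro _ ⟨z, hz, rfl⟩
    exact (isFixedPt_syncMap_iff ha ha').2 (syncForce_eq_zero_of_mem hz)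

theorem injOn_torusProj_syncFixedPoints : InjOn torusProj syncFixedPoints := by
  have hIco : ∀ z ∈ syncFixedPoints, z.1 ∈ Ico 0 (0 + 2 * π) ∧ z.2 ∈ Ico 0 (0 + 2 * π) := by
    have := Real.pi_pos
    rintro z (rfl | (rfl | rfl | rfl) | rfl | rfl) <;>
      exact ⟨⟨by positivity, by linarith⟩, ⟨by positivity, by linarith⟩⟩
  intro z hz w hw h
  obtain ⟨h₁, h₂⟩ := Prod.ext_iff.1 h
  exact Prod.ext ((AddCircle.coe_eq_coe_iff_of_mem_Ico (hIco z hz).1 (hIco w hw).1).1 h₁)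
    ((AddCircle.coe_eq_coe_iff_of_mem_Ico (hIco z hz).2 (hIco w hw).2).1 h₂)

theorem ncard_syncFixedPoints : syncFixedPoints.ncard = 6 := by
  have hπ := Real.pi_pos
  have h₀ : 0 ≠ 2 * π / 3 := fun h => by linarith
  have h₀' : 0 ≠ 4 * π / 3 := fun h => by linarith
  have h₁ : 2 * π / 3 ≠ π := fun h => by linarith
  have h₂ : 4 * π / 3 ≠ π := fun h => by linarith
  have h₃ : 2 * π / 3 ≠ 4 * π / 3 := fun h => by linarith
  rw [syncFixedPoints, syncSaddles, syncSinks, insert_union, insert_union, singleton_union,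
    ncard_insert_of_notMem, ncard_insert_of_notMem, ncard_insert_of_notMem,
    ncard_insert_of_notMem, ncard_insert_of_notMem, ncard_singleton]
  all_goals simp [hπ.ne, hπ.ne', h₀, h₀', h₁.symm, h₂.symm, h₃]

theorem charpoly_couplingMap (a α β γ : ℝ) :
    (couplingMap a α β γ : ℝ × ℝ →ₗ[ℝ] ℝ × ℝ).charpoly =
      Polynomial.X ^ 2 - Polynomial.C (2 + a * (2 * (α + β + γ))) * Polynomial.X +
        Polynomial.C (1 + a * (2 * (α + β + γ)) + a ^ 2 * (3 * (α * β + β * γ + γ * α))) := by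
  have hM : LinearMap.toMatrix (Module.Basis.finTwoProd ℝ) (Module.Basis.finTwoProd ℝ)
      (couplingMap a α β γ : ℝ × ℝ →ₗ[ℝ] ℝ × ℝ) =
      !![1 + a * (2 * α + γ), a * (β - γ); a * (α - γ), 1 + a * (2 * β + γ)] := by
    ext i j
    fin_cases i <;> fin_cases j <;> simp [LinearMap.toMatrix_apply, couplingMap_apply]
  rw [← LinearMap.charpoly_toMatrix _ (Module.Basis.finTwoProd ℝ), hM, Matrix.charpoly_fin_two,
    Matrix.trace_fin_two_of, Matrix.det_fin_two_of]
  congr 3 <;> ring_nf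

theorem multipliers_syncMap (a : ℝ) {z : ℝ × ℝ} (hz : syncForce z = 0) {μ ν : ℝ}
    (hadd : μ + ν = 2 * (Real.cos z.1 + Real.cos z.2 + Real.cos (z.1 - z.2)))
    (hmul : μ * ν = 3 * (Real.cos z.1 * Real.cos z.2 + Real.cos z.2 * Real.cos (z.1 - z.2) +
      Real.cos (z.1 - z.2) * Real.cos z.1)) :
    multipliers torusModel (syncMap a) (torusProj z) =
      {((1 + a * μ : ℝ) : ℂ), ((1 + a * ν : ℝ) : ℂ)} := by
  have hderiv := returnDeriv_of_semiconj (contDiff_syncLift a) (semiconj_syncLift a)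
    (syncLift_eq_self a hz) (hasFDerivAt_syncLift a z)
  ext ζ
  have hroots : Polynomial.aeval ζ (couplingMap a (Real.cos z.1) (Real.cos z.2)
      (Real.cos (z.1 - z.2)) : ℝ × ℝ →ₗ[ℝ] ℝ × ℝ).charpoly =
      (ζ - (1 + a * μ : ℝ)) * (ζ - (1 + a * ν : ℝ)) := by
    rw [charpoly_couplingMap, ← hadd, ← hmul]
    simp only [map_add, map_sub, map_mul, map_pow, Polynomial.aeval_X, Polynomial.aeval_C,
      Complex.coe_algebraMap]
    push_cast
    ring
  rw [multipliers, hderiv]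
  simp only [mem_ofPred_eq, hroots, mul_eq_zero, sub_eq_zero, mem_insert_iff, mem_singleton_iff]

section Types

variable {a : ℝ} (ha : 0 < a) (ha' : a < 2 / 3)
include ha ha'

theorem isSource_syncMap : IsSource torusModel (syncMap a) (torusProj (0, 0)) := by
  have hz : syncForce (0, 0) = 0 := syncForce_eq_zero_of_mem (Or.inl rfl)
  have hpos : 1 < |1 + a * 3| := lt_abs.2 (Or.inl (by linarith))
  exact isSource_of_multipliers_eq ((isFixedPt_syncMap_iff ha ha').2 hz)
    (multipliers_syncMap a hz (by norm_num) (by norm_num)) hpos hpos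

theorem isSaddle_syncMap {z : ℝ × ℝ} (hz : z ∈ syncSaddles) :
    IsSaddle torusModel (syncMap a) (torusProj z) := by
  have hz₀ : syncForce z = 0 := syncForce_eq_zero_of_mem (Or.inr (Or.inl hz))
  refine isSaddle_of_multipliers_eq ((isFixedPt_syncMap_iff ha ha').2 hz₀)
    (multipliers_syncMap a hz₀ (μ := -3) (ν := 1) ?_ ?_)
    (abs_lt.2 ⟨by linarith, by linarith⟩) (lt_abs.2 (Or.inl (by linarith))) <;>
    rcases hz with rfl | rfl | rfl <;> norm_num

theorem isSink_syncMap {z : ℝ × ℝ} (hz : z ∈ syncSinks) :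
    IsSink torusModel (syncMap a) (torusProj z) := by
  have hz₀ : syncForce z = 0 := syncForce_eq_zero_of_mem (Or.inr (Or.inr hz))
  obtain ⟨hα, hβ, hγ⟩ := cos_of_mem_syncSinks hz
  have hlt : |1 + a * (-3 / 2)| < 1 := abs_lt.2 ⟨by linarith, by linarith⟩
  refine isSink_of_multipliers_eq ((isFixedPt_syncMap_iff ha ha').2 hz₀)
    (multipliers_syncMap a hz₀ ?_ ?_) hlt hlt <;> rw [hα, hβ, hγ] <;> norm_num

end Types

/-! ### Transversality -/

section Transversality

variable {a : ℝ} (ha : 0 < a) (ha' : a < 1 / 3)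

include ha in
theorem stableTangent_syncMap_eq_top (ha' : a < 2 / 3) {z : ℝ × ℝ} (hz : z ∈ syncSinks) {x : Torus}
    (hx : x ∈ stableSet (syncMap a) (torusProj z)) :
    stableTangent torusModel (syncMap a) (torusProj z) x = ⊤ := by
  have hfix : syncLift a z = z := syncLift_eq_self a (syncForce_eq_zero_of_mem (Or.inr (Or.inr hz)))
  obtain ⟨hα, hβ, hγ⟩ := cos_of_mem_syncSinks hz
  have hderiv := hasFDerivAt_syncLift a z
  rw [hα, hβ, hγ, couplingMap_self] at hderiv
  exact stableTangent_eq_top_of_semiconj (isStrictLyapunov_syncMap ha ha').continuous_map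
    (semiconj_syncLift a) hfix (exists_attractsUniformlyOn_of_hasFDerivAt_smul_id
      (abs_lt.2 ⟨by linarith, by linarith⟩) hfix hderiv) hx

theorem stableTangent_syncDiffeo_symm_eq_top {x : Torus}
    (hx : x ∈ stableSet (syncDiffeo ha ha').symm (torusProj (0, 0))) :
    stableTangent torusModel (syncDiffeo ha ha').symm (torusProj (0, 0)) x = ⊤ := by
  have hfix : syncLift a (0, 0) = (0, 0) :=
    syncLift_eq_self a (syncForce_eq_zero_of_mem (Or.inl rfl))
  have hderiv :
      HasFDerivAt (syncLift a) ((1 + 3 * a) • ContinuousLinearMap.id ℝ (ℝ × ℝ)) (0, 0) := by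
    simpa [couplingMap_self] using hasFDerivAt_syncLift a (0, 0)
  exact stableTangent_eq_top_of_semiconj (syncDiffeo ha ha').symm.continuous
    (semiconj_syncLiftDiffeo_symm ha ha') ((syncLiftDiffeo ha ha').symm_apply_eq.2 hfix.symm)
    (exists_attractsUniformlyOn_symm_of_hasFDerivAt_smul_id
      (e := (syncLiftDiffeo ha ha').toHomeomorph) (lt_abs.2 (Or.inl (by linarith))) hfix hderiv) hx

theorem mem_stableTangent_syncDiffeo_of_line {z u : ℝ × ℝ}
    (hu : ∀ t : ℝ, syncLift a (z + t • u) = z + stableLineMap a t • u) :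
    u ∈ stableTangent torusModel (syncDiffeo ha ha') (torusProj z) (torusProj z) := by
  have hsemi : Semiconj (fun t : ℝ => torusProj (z + t • u)) (stableLineMap a)
      (syncDiffeo ha ha') := fun t =>
    (congrArg torusProj (hu t)).symm.trans ((semiconj_syncLift a).eq _)
  have hzero : stableLineMap a 0 = 0 := by simp [stableLineMap]
  have hderiv : HasDerivAt (stableLineMap a) (1 - 3 * a) 0 :=
    ((hasDerivAt_id (0 : ℝ)).sub ((Real.hasDerivAt_sin 0).const_mul (3 * a))).congr_deriv (by simp)
  exact mem_stableTangent_of_semiconj_line hsemi hzero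
    (exists_attractsUniformlyOn_of_hasFDerivAt_smul_id (c := 1 - 3 * a)
      (abs_lt.2 ⟨by linarith, by linarith⟩) hzero (hderiv.hasFDerivAt.congr_fderiv (by ext; simp)))

theorem mem_stableTangent_syncDiffeo_symm_of_line {z w : ℝ × ℝ}
    (hw : ∀ t : ℝ, syncLift a (z + t • w) = z + unstableLineMap a t • w) :
    w ∈ stableTangent torusModel (syncDiffeo ha ha').symm (torusProj z) (torusProj z) := by
  have hsemi : Semiconj (fun t : ℝ => torusProj (z + t • w)) (unstableLineDiffeo ha ha')
      (syncDiffeo ha ha') := fun t =>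
    (congrArg torusProj (hw t)).symm.trans ((semiconj_syncLift a).eq _)
  have hsemi_symm := hsemi.inverses_right (unstableLineDiffeo ha ha').apply_symm_apply
    (syncDiffeo ha ha').symm_apply_apply
  have hzero : unstableLineMap a 0 = 0 := by simp [unstableLineMap]
  have hderiv : HasDerivAt (unstableLineMap a) (1 + a) 0 :=
    ((hasDerivAt_id (0 : ℝ)).add ((((hasDerivAt_id (0 : ℝ)).const_mul 2).sin.sub
      (Real.hasDerivAt_sin 0)).const_mul a)).congr_deriv (by norm_num)
  exact mem_stableTangent_of_semiconj_line hsemi_symm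
    ((unstableLineDiffeo ha ha').symm_apply_eq.2 hzero.symm)
    (exists_attractsUniformlyOn_symm_of_hasFDerivAt_smul_id (c := 1 + a)
      (e := (unstableLineDiffeo ha ha').toHomeomorph) (lt_abs.2 (Or.inl (by linarith))) hzero
      (hderiv.hasFDerivAt.congr_fderiv (by ext; simp)))

theorem sup_stableTangent_eq_top_of_lines {z u w : ℝ × ℝ}
    (hu : ∀ t : ℝ, syncLift a (z + t • u) = z + stableLineMap a t • u)
    (hw : ∀ t : ℝ, syncLift a (z + t • w) = z + unstableLineMap a t • w)
    (hdet : u.1 * w.2 - u.2 * w.1 ≠ 0) :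
    stableTangent torusModel (syncDiffeo ha ha') (torusProj z) (torusProj z) ⊔
      stableTangent torusModel (syncDiffeo ha ha').symm (torusProj z) (torusProj z) = ⊤ :=
  sup_eq_top_of_mem_of_det_ne_zero (mem_stableTangent_syncDiffeo_of_line ha ha' hu)
    (mem_stableTangent_syncDiffeo_symm_of_line ha ha' hw) hdet

theorem sup_stableTangent_eq_top_of_mem_syncSaddles {z : ℝ × ℝ} (hz : z ∈ syncSaddles) :
    stableTangent torusModel (syncDiffeo ha ha') (torusProj z) (torusProj z) ⊔
      stableTangent torusModel (syncDiffeo ha ha').symm (torusProj z) (torusProj z) = ⊤ := by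
  have hpi (t : ℝ) : Real.sin (π + t) = -Real.sin t := by rw [add_comm, Real.sin_add_pi]
  have hpi' (t : ℝ) : Real.sin (π + t - 2 * t) = Real.sin t := by
    rw [show π + t - 2 * t = π - t by ring, Real.sin_pi_sub]
  have hpi'' (t : ℝ) : Real.sin (2 * t - (π + t)) = -Real.sin t := by
    rw [show 2 * t - (π + t) = t - π by ring, Real.sin_sub_pi]
  have hdouble (t : ℝ) : Real.sin (π + t - (π + -t)) = Real.sin (2 * t) := by ring_nf
  rcases hz with rfl | rfl | rfl
  · refine sup_stableTangent_eq_top_of_lines ha ha' (u := (0, 1)) (w := (2, 1)) (fun t => ?_)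
      (fun t => ?_) (by norm_num) <;> ext <;>
    simp only [syncLift, syncForce, stableLineMap, unstableLineMap, Prod.fst_add, Prod.snd_add,
      Prod.smul_fst, Prod.smul_snd, smul_eq_mul, mul_zero, mul_one, add_zero, zero_add, zero_sub,
      Real.sin_zero, mul_comm t 2, Real.sin_neg, hpi, hpi''] <;> ring
  · refine sup_stableTangent_eq_top_of_lines ha ha' (u := (1, 0)) (w := (1, 2)) (fun t => ?_)
      (fun t => ?_) (by norm_num) <;> ext <;>
    simp only [syncLift, syncForce, stableLineMap, unstableLineMap, Prod.fst_add, Prod.snd_add,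
      Prod.smul_fst, Prod.smul_snd, smul_eq_mul, mul_zero, mul_one, add_zero, zero_add, sub_zero,
      Real.sin_zero, mul_comm t 2, hpi, hpi'] <;> ring
  · refine sup_stableTangent_eq_top_of_lines ha ha' (u := (1, 1)) (w := (1, -1)) (fun t => ?_)
      (fun t => ?_) (by norm_num) <;> ext <;>
    simp only [syncLift, syncForce, stableLineMap, unstableLineMap, Prod.fst_add, Prod.snd_add,
      Prod.smul_fst, Prod.smul_snd, smul_eq_mul, mul_one, mul_neg, sub_self, Real.sin_zero,
      Real.sin_neg, hpi, hdouble] <;> ring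

theorem syncPotential_torusProj_zero : syncPotential (torusProj (0, 0)) = 3 := by
  rw [syncPotential_torusProj]
  norm_num

theorem syncPotential_torusProj_of_mem_syncSaddles {z : ℝ × ℝ} (hz : z ∈ syncSaddles) :
    syncPotential (torusProj z) = -1 := by
  rw [syncPotential_torusProj]
  rcases hz with rfl | rfl | rfl <;> norm_num

theorem syncPotential_torusProj_of_mem_syncSinks {z : ℝ × ℝ} (hz : z ∈ syncSinks) :
    syncPotential (torusProj z) = -(3 / 2) := by
  obtain ⟨hα, hβ, hγ⟩ := cos_of_mem_syncSinks hz
  rw [syncPotential_torusProj, hα, hβ, hγ]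
  norm_num

theorem mem_syncSinks_or_eq_zero_of_syncPotential_lt {z w : ℝ × ℝ} (hz : z ∈ syncFixedPoints)
    (hw : w ∈ syncFixedPoints) (h : syncPotential (torusProj z) < syncPotential (torusProj w)) :
    z ∈ syncSinks ∨ w = (0, 0) := by
  rcases hw with hw | hw
  · exact Or.inr hw
  have hw : syncPotential (torusProj w) ≤ -1 := by
    rcases hw with hw | hw
    · exact (syncPotential_torusProj_of_mem_syncSaddles hw).le
    · linarith [syncPotential_torusProj_of_mem_syncSinks hw]
  rcases hz with rfl | hz | hz
  · linarith [syncPotential_torusProj_zero]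
  · linarith [syncPotential_torusProj_of_mem_syncSaddles hz]
  · exact Or.inl hz

theorem isHyperbolicPeriodicPt_syncMap (ha : 0 < a) (ha' : a < 2 / 3) {z : ℝ × ℝ}
    (hz : z ∈ syncFixedPoints) : IsHyperbolicPeriodicPt torusModel (syncMap a) (torusProj z) := by
  rcases hz with rfl | hz | hz
  · exact (isSource_syncMap ha ha').2.1
  · exact (isSaddle_syncMap ha ha' hz).2.1
  · exact (isSink_syncMap ha ha' hz).2.1

theorem isMorseSmale_syncDiffeo : IsMorseSmale torusModel (syncDiffeo ha ha') := by
  have hlt : a < 2 / 3 := ha'.trans (by norm_num)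
  have hV : IsStrictLyapunov (syncDiffeo ha ha') syncPotential := isStrictLyapunov_syncMap ha hlt
  have hfix : fixedPoints (syncDiffeo ha ha') = torusProj '' syncFixedPoints :=
    fixedPoints_syncMap ha hlt
  have hfix_symm {z : ℝ × ℝ} (hz : z ∈ syncFixedPoints) :
      IsFixedPt (syncDiffeo ha ha').symm (torusProj z) :=
    ((isFixedPt_syncMap_iff ha hlt).2 (syncForce_eq_zero_of_mem hz)).to_leftInverse
      (syncDiffeo ha ha').symm_apply_apply
  have hsink {z : ℝ × ℝ} (hz : z ∈ syncSinks) {x : Torus}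
      (hx : x ∈ stableSet (syncDiffeo ha ha') (torusProj z)) :
      stableTangent torusModel (syncDiffeo ha ha') (torusProj z) x = ⊤ :=
    stableTangent_syncMap_eq_top ha hlt hz hx
  refine hV.isMorseSmale ?_ ?_ ?_ ?_ <;> rw [hfix]
  · exact (finite_of_ncard_ne_zero (by rw [ncard_syncFixedPoints]; norm_num)).image _
  · rintro _ ⟨z, hz, rfl⟩
    exact isHyperbolicPeriodicPt_syncMap ha hlt hz
  · rintro _ ⟨z, rfl | hz | hz, rfl⟩
    · rw [stableTangent_syncDiffeo_symm_eq_top ha ha'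
        (self_mem_stableSet (hfix_symm (Or.inl rfl))), sup_top_eq]
    · exact sup_stableTangent_eq_top_of_mem_syncSaddles ha ha' hz
    · rw [hsink hz (self_mem_stableSet (hfix.ge ⟨z, Or.inr (Or.inr hz), rfl⟩)), top_sup_eq]
  · rintro _ ⟨z, hz, rfl⟩ _ ⟨w, hw, rfl⟩ hVzw x ⟨hxz, hxw⟩
    rcases mem_syncSinks_or_eq_zero_of_syncPotential_lt hz hw hVzw with hz | rfl
    · rw [hsink hz hxz, top_sup_eq]
    · rw [stableTangent_syncDiffeo_symm_eq_top ha ha' hxw, sup_top_eq]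

end Transversality

theorem image_torusProj_syncFixedPoints : torusProj '' syncFixedPoints =
    {torusPt 0 0, torusPt 0 π, torusPt π 0, torusPt π π,
      torusPt (2 * π / 3) (4 * π / 3), torusPt (4 * π / 3) (2 * π / 3)} := by
  simp only [syncFixedPoints, syncSaddles, syncSinks, insert_union, singleton_union,
    image_insert_eq, image_singleton, torusProj]

theorem proposition2p1 (a : ℝ) (ha : 0 < a) (ha' : a < 1 / 3) :
    ∃ G : Torus ≃ₘ^1⟮torusModel, torusModel⟯ Torus,
      (∀ z, G z = syncMap a z) ∧
      IsMorseSmale torusModel G ∧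
      nonwanderingSet G =
        {torusPt 0 0, torusPt 0 π, torusPt π 0, torusPt π π,
          torusPt (2 * π / 3) (4 * π / 3), torusPt (4 * π / 3) (2 * π / 3)} ∧
      (nonwanderingSet G).ncard = 6 ∧
      IsSource torusModel G (torusPt 0 0) ∧
      IsSaddle torusModel G (torusPt 0 π) ∧
      IsSaddle torusModel G (torusPt π 0) ∧
      IsSaddle torusModel G (torusPt π π) ∧
      IsSink torusModel G (torusPt (2 * π / 3) (4 * π / 3)) ∧
      IsSink torusModel G (torusPt (4 * π / 3) (2 * π / 3)) := by
  have hlt : a < 2 / 3 := ha'.trans (by norm_num)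
  have hΩ : nonwanderingSet (syncDiffeo ha ha') = torusProj '' syncFixedPoints :=
    (isStrictLyapunov_syncMap ha hlt).nonwanderingSet_eq.trans (fixedPoints_syncMap ha hlt)
  have hsaddle {z : ℝ × ℝ} (hz : z ∈ syncSaddles) := isSaddle_syncMap ha hlt hz
  have hsink {z : ℝ × ℝ} (hz : z ∈ syncSinks) := isSink_syncMap ha hlt hz
  refine ⟨syncDiffeo ha ha', fun _ => rfl, isMorseSmale_syncDiffeo ha ha',
    hΩ.trans image_torusProj_syncFixedPoints, ?_, isSource_syncMap ha hlt,
    hsaddle (z := (0, π)) (by simp [syncSaddles]), hsaddle (z := (π, 0)) (by simp [syncSaddles]),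
    hsaddle (z := (π, π)) (by simp [syncSaddles]),
    hsink (z := (2 * π / 3, 4 * π / 3)) (Or.inl rfl),
    hsink (z := (4 * π / 3, 2 * π / 3)) (Or.inr rfl)⟩
  rw [hΩ, injOn_torusProj_syncFixedPoints.ncard_image, ncard_syncFixedPoints]
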